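/- Let $k$ be an algebraically closed field of characteristic $p>0$, let $A=k[x_0,\dots,x_N]$ be graded by $\deg x_j=q_j>0$, and put $d=q_0+\dots+q_N$. Let $\alpha_1,\dots,\alpha_m$ be the exponents $\alpha_i=(a_{i,0},\dots,a_{i,N})\in\mathbb Z_{\ge0}^{N+1}$ with $\sum_j q_ja_{i,j}=d$, in any fixed order. For indeterminates $s=(s_1,\dots,s_m)$, $t=(t_1,\dots,t_m)$ set $$G(s)=\sum_i s_ix^{\alpha_i}\in A[s],\qquad \widetilde G(s,t)=\sum_i(s_i+pt_i)x^{\alpha_i}\in W(k)[x_0,\dots,x_N][s,t].$$ Let $\phi$ be the ring endomorphism of $W(k)[x_0,\dots,x_N][s,t]$ that is the Witt vector Frobenius on $W(k)$ and raises each variable $x_j,s_i,t_i$ to its $p$-th power, and let $\Delta(G)(s,t)\in A[s,t]$ be the reduction of $\frac1p\bigl(\widetilde G^{\,p}-\phi(\widetilde G)\bigr)$. Put $G_1(s,t)=G(s)^{p-2}$ and, for $n\ge2$, $$G_n(s,t)=G(s)^{p^n-p^{n-1}-\dots-p-2}\,\Delta(G)(s,t)^{p^{n-2}+\dots+p+1}.$$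 Let $G_{n,i}(s,t)\in k[s,t]$ be the coefficient of $(x_0\cdots x_N)^{p^n-1}x^{-\alpha_i}$ in $G_n(s,t)$ (zero if this is not a monomial with nonnegative exponents), and let $\mathcal G_n(s,t)$ be the $n\times m$ matrix $(G_{r,i}(s,t))_{1\le r\le n,\,1\le i\le m}$. A ring $R$ of characteristic $p$ is $n$-quasi-$F$-split if there is a $W_n(R)$-linear map $F_*W_n(R)\to R$ whose composite with $F\colon W_n(R)\to F_*W_n(R)$ is the restriction $W_n(R)\to R$; $R$ is quasi-$F$-split if this holds for some $n\ge1$, and $\mathrm{ht}(R)\in\mathbb Z_{\ge1}\cup\{\infty\}$ is the least such $n$ ($\infty$ if there is none). For a $\mathbb Q$-divisor $D\ge0$ on $\operatorname{Spec}A$ put $$W_n(A)(pD)=\{(a_0,\dots,a_{n-1})\in W_n(\operatorname{Frac}A)\mid a_i=0\text{ or }\operatorname{div}(a_i)+\lfloor p^{i+1}D\rfloor\ge0\text{ for all }i\}.$$ The pair $(A,D)$ is $n$-quasi-$F$-split if there is a $W_n(A)$-linear map $F_*W_n(A)(pD)\to A$ whose composite with $F\colon W_n(A)\to F_*W_n(A)\subseteq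 F_*W_n(A)(pD)$ is the restriction $W_n(A)\to A$. For $0\ne f\in A$, the non-splitting index $\mathrm{ns}(f)\in\mathbb Z_{\ge1}\cup\{\infty\}$ is the least $n\ge1$ such that $\bigl(A,(1-\frac2{p^n})\operatorname{div}(f)\bigr)$ is not $n$-quasi-$F$-split ($\infty$ if there is none). **Theorem.** Let $0\ne b=(b_1,\dots,b_m)\in k^m$ and $G(b)=\sum_ib_ix^{\alpha_i}\in A$. 1. The minimum below exists, and $\mathrm{ns}(G(b))\ \ge\ \min\{n\ge1\mid \operatorname{rank}\mathcal G_n(b,0)\le n-1\}$. 2. Let $n\ge1$. If $\mathrm{ht}(A/G(b))\ge n$ and $\mathrm{ns}(G(b))\ge n+1$, then $\operatorname{rank}\mathcal G_n(b,0)=n$. In particular, if $A/G(b)$ is not quasi-$F$-split, then $\mathrm{ns}(G(b))=\min\{n\ge1\mid \operatorname{rank}\mathcal G_n(b,0)\le n-1\}$. -/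

import Mathlib

/-! ## Quasi-Frobenius splitting -/

/-- `R` is `n`-quasi-`F`-split: there is a `W_n(R)`-linear map `ψ : F_* W_n(R) → R` whose composite
with the Frobenius `F : W_n(R) → F_* W_n(R)` is the restriction `W_n(R) → R`. (Equivalently: `R`
splits off the pushout of `F : W_n(R) → F_* W_n(R)` along `W_n(R) → R`.)

A map out of `W_n(R) = W(R) / V^n W(R)` is written as a map out of the ring `W(R)` of `p`-typical
Witt vectors that kills the vectors whose first `n` components vanish. -/
def IsNQuasiFSplit (p : ℕ) [Fact p.Prime] (n : ℕ) (R : Type*) [CommRing R] : Prop :=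
  ∃ ψ : WittVector p R →+ R,
    (∀ x : WittVector p R, (∀ i < n, x.coeff i = 0) → ψ x = 0) ∧
    (∀ a x : WittVector p R, ψ (WittVector.frobenius a * x) = a.coeff 0 * ψ x) ∧
    (∀ a : WittVector p R, ψ (WittVector.frobenius a) = a.coeff 0)

/-- `R` is quasi-`F`-split if it is `n`-quasi-`F`-split for some `n ≥ 1`. -/
def IsQuasiFSplit (p : ℕ) [Fact p.Prime] (R : Type*) [CommRing R] : Prop :=
  ∃ n : ℕ, 1 ≤ n ∧ IsNQuasiFSplit p n R

/-- The quasi-`F`-split height: the infimum of all `n ≥ 1` such that `R` is `n`-quasi-`F`-split,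
and `∞` if there is none. -/
noncomputable def qFSplitHeight (p : ℕ) [Fact p.Prime] (R : Type*) [CommRing R] : ℕ∞ :=
  ⨅ (n : ℕ) (_ : 1 ≤ n ∧ IsNQuasiFSplit p n R), (n : ℕ∞)

/-! ## Divisors on a factorial ring and quasi-Frobenius splitting of pairs

In a factorial domain `A` the prime divisors of `Spec A` are the `V(π)` with `π` a prime element;
a `ℚ`-divisor is given by its coefficient `D π` along `V(π)`. -/

/-- The order of vanishing along `V(π)` of a nonzero element `a` of the fraction field of `A`. -/
noncomputable def ordAlong {A : Type*} [CommRing A] [IsDomain A] [UniqueFactorizationMonoid A]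
    (π : A) (a : FractionRing A) : ℤ :=
  (multiplicity π (IsFractionRing.num A a) : ℤ) -
    (multiplicity π (IsFractionRing.den A a : A) : ℤ)

/-- `A(D) = {a ∈ Frac A | a = 0 or div a + ⌊D⌋ ≥ 0}`. -/
def divisorSections {A : Type*} [CommRing A] [IsDomain A] [UniqueFactorizationMonoid A]
    (D : A → ℚ) : Set (FractionRing A) :=
  {a | a = 0 ∨ ∀ π : A, Prime π → 0 ≤ ordAlong π a + ⌊D π⌋}

/-- The preimage in `W(Frac A)` of
`W_n(A)(D) = {(a_0, …, a_{n-1}) ∈ W_n(Frac A) | a_i ∈ A(p^i D) for all i}`. -/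
def wittDivisorSections (p : ℕ) [Fact p.Prime] (n : ℕ) {A : Type*} [CommRing A] [IsDomain A]
    [UniqueFactorizationMonoid A] (D : A → ℚ) : Set (WittVector p (FractionRing A)) :=
  {w | ∀ i < n, w.coeff i ∈ divisorSections (fun π => (p : ℚ) ^ i * D π)}

/-- The pair `(A, D)` is `n`-quasi-`F`-split: there is a `W_n(A)`-linear map
`ψ : F_* W_n(A)(pD) → A` whose composite with `W_n(A) → F_* W_n(A) → F_* W_n(A)(pD)`
is the restriction `W_n(A) → A`. By the universal property of the pushout `Q` of these maps, this
says that `Hom(Q, A) → A` is surjective.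

`W_n(A)(pD)` is a subgroup of `W_n(Frac A)` stable under the action of `W_n(A)` through `F`; only
the values of `ψ` on it matter. As above `W_n` is written as `W` modulo the vectors whose
first `n` components vanish. -/
def IsNQuasiFSplitPair (p : ℕ) [Fact p.Prime] (n : ℕ) (A : Type*) [CommRing A] [IsDomain A]
    [UniqueFactorizationMonoid A] (D : A → ℚ) : Prop :=
  ∃ ψ : WittVector p (FractionRing A) → A,
    (∀ x ∈ wittDivisorSections p n (fun π => (p : ℚ) * D π),
      ∀ y ∈ wittDivisorSections p n (fun π => (p : ℚ) * D π), ψ (x + y) = ψ x + ψ y) ∧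
    (∀ x : WittVector p (FractionRing A), (∀ i < n, x.coeff i = 0) → ψ x = 0) ∧
    (∀ a : WittVector p A, ∀ x ∈ wittDivisorSections p n (fun π => (p : ℚ) * D π),
      ψ (WittVector.map (algebraMap A (FractionRing A)) (WittVector.frobenius a) * x) =
        a.coeff 0 * ψ x) ∧
    (∀ a : WittVector p A,
      ψ (WittVector.map (algebraMap A (FractionRing A)) (WittVector.frobenius a)) = a.coeff 0)

/-- The non-splitting index of a nonzero `f`: the infimum of all `n ≥ 1` such that
`(A, (1 - 2 / p^n) div f)` is not `n`-quasi-`F`-split, and `∞` if there is none. -/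
noncomputable def nonSplittingIndex (p : ℕ) [Fact p.Prime] {A : Type*} [CommRing A] [IsDomain A]
    [UniqueFactorizationMonoid A] (f : A) : ℕ∞ :=
  ⨅ (n : ℕ) (_ : 1 ≤ n ∧
      ¬ IsNQuasiFSplitPair p n A (fun π => (1 - 2 / (p : ℚ) ^ n) * (multiplicity π f : ℚ))),
    (n : ℕ∞)

/-! ## Universal weighted Calabi–Yau polynomials -/

namespace CYFamily

open MvPolynomial

/-- The exponents of the monomials in `x_0, …, x_N` of weighted degree `d = q_0 + ⋯ + q_N`. -/
abbrev Exponents {N : ℕ} (q : Fin (N + 1) → ℕ) : Type :=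
  {a : Fin (N + 1) →₀ ℕ // ∑ j, q j * a j = ∑ j, q j}

/-- `k[s_1, …, s_m, t_1, …, t_m]`, with `s_i = X (Sum.inl i)` and `t_i = X (Sum.inr i)`. -/
abbrev Params (m : ℕ) (k : Type*) [CommRing k] : Type _ := MvPolynomial (Fin m ⊕ Fin m) k

/-- `k[x_0, …, x_N][s, t]`, written as polynomials in `x` with coefficients in `k[s, t]`. -/
abbrev Univ (N m : ℕ) (k : Type*) [CommRing k] : Type _ :=
  MvPolynomial (Fin (N + 1)) (Params m k)

variable {N m : ℕ} {q : Fin (N + 1) → ℕ}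

/-- `G(s) = ∑ s_i x^{α_i}`. -/
noncomputable def G (k : Type*) [CommRing k] (α : Fin m ≃ Exponents q) : Univ N m k :=
  ∑ i, monomial (α i).1 (X (Sum.inl i))

/-- `G(b) = ∑ b_i x^{α_i}` for `b ∈ k^m`. -/
noncomputable def Gval {k : Type*} [CommRing k] (α : Fin m ≃ Exponents q) (b : Fin m → k) :
    MvPolynomial (Fin (N + 1)) k :=
  ∑ i, monomial (α i).1 (b i)

/-- `G̃(s, t) = ∑ (s_i + p t_i) x^{α_i}`, with coefficients in `W(k)[s, t]`. -/
noncomputable def Gtilde (p : ℕ) [Fact p.Prime] (k : Type*) [CommRing k]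
    (α : Fin m ≃ Exponents q) : Univ N m (WittVector p k) :=
  ∑ i, monomial (α i).1 (X (Sum.inl i) + (p : Params m (WittVector p k)) * X (Sum.inr i))

/-- The restriction of `φ` to `W(k)[s, t]`. -/
noncomputable def phiParams (p : ℕ) [Fact p.Prime] (m : ℕ) (k : Type*) [CommRing k] :
    Params m (WittVector p k) →+* Params m (WittVector p k) :=
  eval₂Hom (C.comp WittVector.frobenius) (fun v => X v ^ p)

/-- The lift `φ` of Frobenius on `W(k)[x][s, t]`: Frobenius on `W(k)`, and the `p`-th power on all
the variables. -/
noncomputable def phi (p : ℕ) [Fact p.Prime] (N m : ℕ) (k : Type*) [CommRing k] :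
    Univ N m (WittVector p k) →+* Univ N m (WittVector p k) :=
  eval₂Hom (C.comp (phiParams p m k)) (fun j => X j ^ p)

/-- The reduction `W(k)[x][s, t] → k[x][s, t]`. -/
noncomputable def reduction (p : ℕ) [Fact p.Prime] (N m : ℕ) (k : Type*) [CommRing k] :
    Univ N m (WittVector p k) →+* Univ N m k :=
  map (map WittVector.constantCoeff)

theorem dvd_pow_sub_frobenius (p : ℕ) [Fact p.Prime] {k : Type*} [Field k] [CharP k p]
    [IsAlgClosed k] (w : WittVector p k) :
    (p : WittVector p k) ∣ w ^ p - WittVector.frobenius w := by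
  rw [← Ideal.mem_span_singleton, WittVector.mem_span_p_iff_coeff_zero_eq_zero]
  have h : WittVector.constantCoeff (w ^ p - WittVector.frobenius w) = 0 := by
    rw [map_sub, map_pow, sub_eq_zero]
    exact (WittVector.coeff_frobenius_charP p w 0).symm
  exact h

theorem dvd_pow_sub_eval₂Hom (p : ℕ) [Fact p.Prime] {R σ : Type*} [CommRing R] (F : R →+* R)
    (hF : ∀ r, (p : R) ∣ r ^ p - F r) (g : MvPolynomial σ R) :
    (p : MvPolynomial σ R) ∣ g ^ p - eval₂Hom (C.comp F) (fun v => X v ^ p) g := by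
  induction g using MvPolynomial.induction_on with
  | C r =>
    have h := map_dvd (C : R →+* MvPolynomial σ R) (hF r)
    simpa using h
  | add a b ha hb =>
    obtain ⟨c, hc⟩ := exists_add_pow_prime_eq (Fact.out : p.Prime) a b
    rw [hc, map_add]
    convert dvd_add (dvd_add ha hb) (Dvd.intro (a * b * c) rfl) using 1
    ring
  | mul_X a v ha =>
    rw [mul_pow, map_mul, coe_eval₂Hom, eval₂_X, ← coe_eval₂Hom, ← sub_mul]
    exact Dvd.dvd.mul_right ha _

theorem dvd_pow_sub_phi (p : ℕ) [Fact p.Prime] (N m : ℕ) {k : Type*} [Field k] [CharP k p]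
    [IsAlgClosed k] (g : Univ N m (WittVector p k)) :
    (p : Univ N m (WittVector p k)) ∣ g ^ p - phi p N m k g :=
  dvd_pow_sub_eval₂Hom p (phiParams p m k)
    (dvd_pow_sub_eval₂Hom p WittVector.frobenius (dvd_pow_sub_frobenius p)) g

/-- `Δ(G)(s, t) ∈ k[x][s, t]`, the reduction of `(G̃(s, t)^p - φ(G̃(s, t))) / p`. The quotient by
`p` is unique because `W(k)[x][s, t]` is a domain of characteristic zero. -/
noncomputable def DeltaG (p : ℕ) [Fact p.Prime] (k : Type*) [Field k] [CharP k p]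
    [IsAlgClosed k] (α : Fin m ≃ Exponents q) : Univ N m k :=
  reduction p N m k (dvd_pow_sub_phi p N m (Gtilde p k α)).choose

/-- `G_n(s, t) = G(s)^{p^n - p^{n-1} - ⋯ - p - 2} Δ(G)(s, t)^{p^{n-2} + ⋯ + p + 1}` for `n ≥ 1`;
for `n = 1` this is `G(s)^{p-2}`. The first exponent is nonnegative, so that the subtraction of
natural numbers is the true one. -/
noncomputable def Gn (p : ℕ) [Fact p.Prime] (k : Type*) [Field k] [CharP k p] [IsAlgClosed k]
    (α : Fin m ≃ Exponents q) (n : ℕ) : Univ N m k :=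
  G k α ^ (p ^ n - ((∑ j ∈ Finset.Ico 1 n, p ^ j) + 2)) *
    DeltaG p k α ^ (∑ j ∈ Finset.range (n - 1), p ^ j)

/-- `G_{n,i}(s, t)`, the coefficient of `x^{p^n - 1 - α_i}` in `G_n(s, t)`; it is zero if one of
the exponents `p^n - 1 - a_{i,j}` is negative. -/
noncomputable def Gcoeff (p : ℕ) [Fact p.Prime] (k : Type*) [Field k] [CharP k p]
    [IsAlgClosed k] (α : Fin m ≃ Exponents q) (n : ℕ) (i : Fin m) : Params m k :=
  open Classical in
  if ∀ j, (α i).1 j ≤ p ^ n - 1 then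
    coeff (Finsupp.equivFunOnFinite.symm fun j => p ^ n - 1 - (α i).1 j) (Gn p k α n)
  else 0

/-- The `n × m` matrix `𝓖_n(b, c)` with rows `(G_{r,1}(b, c), …, G_{r,m}(b, c))`, `1 ≤ r ≤ n`. -/
noncomputable def GMatrix (p : ℕ) [Fact p.Prime] {k : Type*} [Field k] [CharP k p]
    [IsAlgClosed k] (α : Fin m ≃ Exponents q) (n : ℕ) (b c : Fin m → k) :
    Matrix (Fin n) (Fin m) k :=
  Matrix.of fun r i => eval (Sum.elim b c) (Gcoeff p k α (r + 1) i)

end CYFamily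

/-! Write A = k[x], f = G(b), Δ = Δ(G)(b,0), d = ∑ q_j, and let u be the Cartier operator, which
generates Hom(F_*A, A).

The Frobenius lift gives a ring map `sec` : W(k)[x] → W(A), and every Witt vector is sec(c) + V(w').
Along it a W_n(A)-linear map ψ : F_*W_n(A) → A unwinds into W(k)[x]-linear maps χ_i : W(A) → A with
ψ = u ∘ χ_0 and χ_i ∘ V = u ∘ χ_{i+1}. The values g_i = χ_i(1) may be prescribed for i < n, subject
only to u(g_i) = 0 for i ≥ 1 (`exists_system`, `exists_system_of_linear`).

Multiplication by [f]^p turns a splitting of the pair into such a ψ with ψ(1) = 1 that sends into fA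
every y with f² ∣ y_i^{p^{n-1-i}} for all i < n. To test this on multiples of [f], expand [f] =
sec(F) + V(sec(D) + ⋯) with F a lift of f and D a lift of Δ (`dvd_teichmuller_sub`). The outcome is
g_i = f^{p^{i+1}-2} h_i with h_i ≡ θ(h_{i+1}) mod f, where θ(h) = -u(f^{p-2}Δh), together with
u(f^{p-2}h_0) = 1 and u(f^{p-2}h_i) = 0 for i ≥ 1.

Since f has degree d = ∑ q_j, θ preserves forms of degree d, and ν_s(h) = u(f^{p-2}θ^s(h)) is a
constant for such h. A splitting thus comes down to one form h = h_{n-1} of degree d with ν_s(h) = 0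
for s < n-1 and ν_{n-1}(h) ≠ 0. Collapsing the nested Cartier operators shows that ν_s(h) = 0
exactly when row s+1 of the matrix kills the coefficient vector of h (`GMatrix_mulVec_eq_zero_iff`).

Part 1: rank n supplies h, and h_i = θ^{n-1-i}(h) satisfies the recursion exactly. The hypothesis f²
∣ y_i^{p^{n-1-i}} still has to give f ∣ y_i for i < n-1; it does, because the existence of h bounds
the multiplicities of the factors of f (`dvd_of_sq_dvd_pow`).

Part 2: in degree d the recursion holds up to multiples c·f with c ∈ k. They are harmless if ν_s(f)
= 0 for s < n-1, which follows from ht ≥ n, as otherwise the θ-iterates of f would split A/f too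
early (`nu_self_eq_zero`). Splittings for all r ≤ n then give a triangular system of test vectors,
so the rank is n. If A/f is not quasi-F-split, its height is ∞ and the two parts combine. -/

/-! ## The Cartier operator on a polynomial ring -/

namespace MvPolynomial

section Cartier

/-- The exponent `p β + (p - 1, …, p - 1)`. -/
noncomputable def cartierExponent (p : ℕ) {σ : Type*} [Finite σ] (β : σ →₀ ℕ) : σ →₀ ℕ :=
  Finsupp.equivFunOnFinite.symm fun j => p * β j + (p - 1)

theorem cartierExponent_apply (p : ℕ) {σ : Type*} [Finite σ] (β : σ →₀ ℕ) (j : σ) :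
    cartierExponent p β j = p * β j + (p - 1) := rfl

variable (p : ℕ) [Fact p.Prime] {σ k : Type*} [Field k] [CharP k p] [PerfectRing k p]

/-- The generator of `Hom(F_* A, A)` dual to `x^{p-1}`: it extracts the `p`-th roots of the
terms whose exponents are congruent to `-1` modulo `p`. -/
noncomputable def cartierFun [Finite σ] (g : MvPolynomial σ k) : MvPolynomial σ k :=
  open Classical in
  ∑ e ∈ g.support, if ∀ j, e j % p = p - 1 then
    monomial (e.mapRange (· / p) (Nat.zero_div p)) ((frobeniusEquiv k p).symm (g.coeff e)) else 0

variable [Finite σ]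

theorem coeff_cartierFun (g : MvPolynomial σ k) (β : σ →₀ ℕ) :
    (cartierFun p g).coeff β = (frobeniusEquiv k p).symm (g.coeff (cartierExponent p β)) := by
  classical
  have hp : p.Prime := Fact.out
  have key : ∀ e : σ →₀ ℕ, ((∀ j, e j % p = p - 1) ∧
      e.mapRange (· / p) (Nat.zero_div p) = β) ↔ e = cartierExponent p β := by
    intro e
    constructor
    · rintro ⟨h1, rfl⟩
      ext j
      rw [cartierExponent_apply, Finsupp.mapRange_apply, ← h1 j, Nat.div_add_mod]
    · rintro rfl
      have hlt : p - 1 < p := Nat.sub_lt hp.pos one_pos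
      refine ⟨fun j => ?_, ?_⟩
      · rw [cartierExponent_apply, Nat.mul_add_mod, Nat.mod_eq_of_lt hlt]
      · ext j
        rw [Finsupp.mapRange_apply, cartierExponent_apply, Nat.mul_add_div hp.pos,
          Nat.div_eq_of_lt hlt, add_zero]
  have h1 : ∀ e : σ →₀ ℕ, coeff β (if ∀ j, e j % p = p - 1 then
      monomial (e.mapRange (· / p) (Nat.zero_div p)) ((frobeniusEquiv k p).symm (g.coeff e))
      else 0) = if e = cartierExponent p β then (frobeniusEquiv k p).symm (g.coeff e) else 0 := by
    intro e
    by_cases h : ∀ j, e j % p = p - 1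
    · rw [if_pos h, coeff_monomial]
      refine if_congr ?_ rfl rfl
      rw [← key e]
      exact ⟨fun h' => ⟨h, h'⟩, fun h' => h'.2⟩
    · rw [if_neg h, if_neg (fun h' => h ((key e).2 h').1), coeff_zero]
  rw [cartierFun, coeff_sum, Finset.sum_congr rfl (fun e _ => h1 e), Finset.sum_ite_eq']
  split_ifs with h
  · rfl
  · rw [notMem_support_iff.1 h, map_zero]

/-- The Cartier operator as an additive map. -/
noncomputable def cartier : MvPolynomial σ k →+ MvPolynomial σ k where
  toFun := cartierFun p
  map_zero' := by ext; simp [coeff_cartierFun]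
  map_add' a b := by ext; simp [coeff_cartierFun]

theorem coeff_cartier (g : MvPolynomial σ k) (β : σ →₀ ℕ) :
    (cartier p g).coeff β = (frobeniusEquiv k p).symm (g.coeff (cartierExponent p β)) :=
  coeff_cartierFun p g β

theorem cartier_pow_mul (a b : MvPolynomial σ k) : cartier p (a ^ p * b) = a * cartier p b := by
  have hp : p.Prime := Fact.out
  induction a using induction_on' with
  | monomial γ c =>
    ext β
    rw [monomial_pow, coeff_cartier, coeff_monomial_mul', coeff_monomial_mul', coeff_cartier]
    have hle : p • γ ≤ cartierExponent p β ↔ γ ≤ β := by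
      rw [Finsupp.le_def, Finsupp.le_def]
      refine forall_congr' fun j => ?_
      rw [cartierExponent_apply, Finsupp.smul_apply, smul_eq_mul]
      constructor
      · intro h
        by_contra! h'
        have := Nat.mul_le_mul_left p (Nat.succ_le_of_lt h')
        have := hp.pos
        rw [Nat.succ_eq_add_one, mul_add] at *
        omega
      · intro h
        exact (Nat.mul_le_mul_left p h).trans (Nat.le_add_right _ _)
    by_cases h : γ ≤ β
    · rw [if_pos h, if_pos (hle.2 h), map_mul, frobeniusEquiv_symm_pow]
      congr 3
      ext j
      have := Nat.mul_le_mul_left p (h j)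
      simp only [Finsupp.tsub_apply, cartierExponent_apply, Finsupp.smul_apply, smul_eq_mul,
        Nat.mul_sub]
      omega
    · rw [if_neg h, if_neg (fun h' => h (hle.1 h')), map_zero]
  | add a a' ha ha' =>
    rw [add_pow_char, add_mul, map_add, ha, ha', add_mul]

theorem cartier_C_mul (c : k) (b : MvPolynomial σ k) :
    cartier p (C c * b) = C ((frobeniusEquiv k p).symm c) * cartier p b := by
  rw [← cartier_pow_mul, ← map_pow, frobeniusEquiv_symm_pow_p]

theorem pow_dvd_cartier {f g : MvPolynomial σ k} {n : ℕ} (h : f ^ (p * n) ∣ g) :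
    f ^ n ∣ cartier p g := by
  obtain ⟨c, rfl⟩ := h
  rw [mul_comm p n, pow_mul, cartier_pow_mul]
  exact Dvd.intro _ rfl


end Cartier

/-! ### Duality for the Cartier operator -/

section Dual

variable (p : ℕ) [Fact p.Prime] {σ k : Type*} [Field k] [CharP k p] [PerfectRing k p] [Fintype σ]

/-- The exponent with entries `ε j`. -/
noncomputable def digitExponent (ε : σ → Fin p) : σ →₀ ℕ :=
  Finsupp.equivFunOnFinite.symm fun j => (ε j : ℕ)

/-- The exponent with entries `p - 1 - ε j`. -/
noncomputable def codigitExponent (ε : σ → Fin p) : σ →₀ ℕ :=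
  Finsupp.equivFunOnFinite.symm fun j => p - 1 - (ε j : ℕ)

/-- The monomials `x^ε` with `0 ≤ ε_j ≤ p - 1` and `x^{p-1-ε}` are dual for the Cartier operator. -/
theorem sum_cartier_pow_mul [DecidableEq σ] (X : MvPolynomial σ k) :
    ∑ ε : σ → Fin p, cartier p (monomial (codigitExponent p ε) 1 * X) ^ p *
      monomial (digitExponent p ε) 1 = X := by
  have hp : p.Prime := Fact.out
  induction X using induction_on' with
  | monomial e c =>
    let ε₀ : σ → Fin p := fun j => ⟨e j % p, Nat.mod_lt _ hp.pos⟩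
    let β : σ →₀ ℕ := e.mapRange (· / p) (Nat.zero_div p)
    have hval : ∀ ε : σ → Fin p, cartier p (monomial (codigitExponent p ε) 1 * monomial e c) =
        if ε = ε₀ then monomial β ((frobeniusEquiv k p).symm c) else 0 := by
      intro ε
      ext γ
      rw [coeff_cartier, monomial_mul, one_mul, coeff_monomial]
      have hiff : codigitExponent p ε + e = cartierExponent p γ ↔ ε = ε₀ ∧ β = γ := by
        constructor
        · intro h
          have hj : ∀ j, e j = p * γ j + ε j := by
            intro j
            have := DFunLike.congr_fun h j
            have h2 : p - 1 - (ε j : ℕ) + e j = p * γ j + (p - 1) := this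
            have := (ε j).2
            omega
          refine ⟨?_, ?_⟩
          · funext j
            apply Fin.ext
            change (ε j : ℕ) = e j % p
            rw [hj j, Nat.mul_add_mod, Nat.mod_eq_of_lt (ε j).2]
          · ext j
            change e j / p = γ j
            rw [hj j, Nat.mul_add_div hp.pos, Nat.div_eq_of_lt (ε j).2, add_zero]
        · rintro ⟨rfl, rfl⟩
          ext j
          change p - 1 - e j % p + e j = p * (e j / p) + (p - 1)
          have := Nat.div_add_mod (e j) p
          have := Nat.mod_lt (e j) hp.pos
          omega
      by_cases h1 : ε = ε₀
      · rw [if_pos h1, coeff_monomial]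
        by_cases h2 : β = γ
        · rw [if_pos h2, if_pos (hiff.2 ⟨h1, h2⟩)]
        · rw [if_neg h2, if_neg (fun h => h2 (hiff.1 h).2), map_zero]
      · rw [if_neg h1, if_neg (fun h => h1 (hiff.1 h).1), map_zero, coeff_zero]
    rw [Finset.sum_eq_single ε₀]
    · have he : p • β + digitExponent p ε₀ = e := Finsupp.ext fun j => Nat.div_add_mod (e j) p
      rw [hval, if_pos rfl, monomial_pow, frobeniusEquiv_symm_pow_p, monomial_mul, mul_one, he]
    · intro ε _ hε
      rw [hval, if_neg hε, zero_pow hp.ne_zero, zero_mul]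
    · intro h
      exact absurd (Finset.mem_univ _) h
  | add X Y hX hY =>
    conv_rhs => rw [← hX, ← hY]
    rw [← Finset.sum_add_distrib]
    refine Finset.sum_congr rfl fun ε _ => ?_
    rw [mul_add, map_add, add_pow_char, add_mul]

/-- In the expansion of X in the basis x^ε over p-th powers, the coefficients are p-th powers of
values u(c X). -/
theorem pow_dvd_of_dvd_cartier {f X : MvPolynomial σ k} (h : ∀ c, f ∣ cartier p (c * X)) :
    f ^ p ∣ X := by
  classical
  rw [← sum_cartier_pow_mul p X]
  exact Finset.dvd_sum fun ε _ => Dvd.dvd.mul_right (pow_dvd_pow_of_dvd (h _) p) _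

theorem eq_of_cartier_mul_eq {X Y : MvPolynomial σ k}
    (h : ∀ c, cartier p (c * X) = cartier p (c * Y)) : X = Y := by
  classical
  rw [← sum_cartier_pow_mul p X, ← sum_cartier_pow_mul p Y]
  exact Finset.sum_congr rfl fun ε _ => by rw [h]

/-- Every `p⁻¹`-linear endomorphism is a multiple of the Cartier operator. -/
theorem exists_eq_cartier_mul (H : MvPolynomial σ k →+ MvPolynomial σ k)
    (hH : ∀ a b, H (a ^ p * b) = a * H b) : ∃ g, ∀ a, H a = cartier p (a * g) := by
  classical
  refine ⟨∑ ε : σ → Fin p, H (monomial (digitExponent p ε) 1) ^ p *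
    monomial (codigitExponent p ε) 1, fun a => ?_⟩
  conv_lhs => rw [← sum_cartier_pow_mul p a]
  rw [map_sum, Finset.mul_sum, map_sum]
  refine Finset.sum_congr rfl fun ε _ => ?_
  rw [hH, mul_left_comm, cartier_pow_mul, mul_comm, mul_comm a]

end Dual

/-! ### Weighted degrees under the Cartier operator -/

section Weighted

variable (p : ℕ) [Fact p.Prime] {σ k : Type*} [Field k] [CharP k p] [PerfectRing k p] [Fintype σ]

theorem weight_cartierExponent (p : ℕ) {σ : Type*} [Fintype σ] (q : σ → ℕ) (β : σ →₀ ℕ) :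
    Finsupp.weight q (cartierExponent p β) = p * Finsupp.weight q β + (p - 1) * ∑ j, q j := by
  rw [Finsupp.weight_eq_sum, Finsupp.weight_eq_sum, Finset.mul_sum, Finset.mul_sum,
    ← Finset.sum_add_distrib]
  refine Finset.sum_congr rfl fun j _ => ?_
  rw [cartierExponent_apply, smul_eq_mul, smul_eq_mul]
  ring

theorem IsWeightedHomogeneous.cartier {q : σ → ℕ} {g : MvPolynomial σ k} {D E : ℕ}
    (hg : IsWeightedHomogeneous q g D) (hD : D = p * E + (p - 1) * ∑ j, q j) :
    IsWeightedHomogeneous q (MvPolynomial.cartier p g) E := by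
  intro β hβ
  rw [coeff_cartier] at hβ
  have h1 := hg (fun h => hβ (by rw [h, map_zero]))
  rw [weight_cartierExponent, hD] at h1
  exact Nat.eq_of_mul_eq_mul_left (Fact.out : p.Prime).pos (by omega)

theorem weightedHomogeneousComponent_cartier (q : σ → ℕ) (g : MvPolynomial σ k) (E : ℕ) :
    weightedHomogeneousComponent q E (cartier p g) =
      cartier p (weightedHomogeneousComponent q (p * E + (p - 1) * ∑ j, q j) g) := by
  classical
  have hp : p.Prime := Fact.out
  ext β
  rw [coeff_cartier, coeff_weightedHomogeneousComponent, coeff_weightedHomogeneousComponent,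
    coeff_cartier, weight_cartierExponent]
  by_cases h : Finsupp.weight q β = E
  · rw [if_pos h, if_pos (by rw [h])]
  · rw [if_neg h, if_neg, map_zero]
    intro h'
    exact h (Nat.eq_of_mul_eq_mul_left hp.pos (by omega))

theorem weightedHomogeneousComponent_mul_left {σ R : Type*} [CommRing R] (q : σ → ℕ)
    {F : MvPolynomial σ R} {D : ℕ} (hF : IsWeightedHomogeneous q F D) (g : MvPolynomial σ R)
    (E : ℕ) : weightedHomogeneousComponent q (D + E) (F * g) =
      F * weightedHomogeneousComponent q E g := by
  classical
  induction g using induction_on' with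
  | monomial γ c =>
    have h2 := hF.mul (isWeightedHomogeneous_monomial q γ c rfl)
    rw [weightedHomogeneousComponent_of_mem h2,
      weightedHomogeneousComponent_of_mem (isWeightedHomogeneous_monomial q γ c rfl)]
    by_cases h : E = Finsupp.weight q γ
    · rw [if_pos h, if_pos (by rw [h])]
    · rw [if_neg h, if_neg (by omega), mul_zero]
  | add a b ha hb => rw [mul_add, map_add, ha, hb, map_add, mul_add]

end Weighted

end MvPolynomial

/-! ## The section of `W(k[x]) → k[x]` over `W(k)[x]` defined by the Frobenius lift -/

namespace WittSection

open MvPolynomial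

section Defs

variable (p : ℕ) [Fact p.Prime] (σ k : Type*) [Field k]

/-- Reduction modulo `p`. -/
noncomputable def red : MvPolynomial σ (WittVector p k) →+* MvPolynomial σ k :=
  MvPolynomial.map WittVector.constantCoeff

/-- The lift of Frobenius to `W(k)[x]` raising the variables to the `p`-th power. -/
noncomputable def frobLift :
    MvPolynomial σ (WittVector p k) →+* MvPolynomial σ (WittVector p k) :=
  eval₂Hom (C.comp WittVector.frobenius) (fun j => X j ^ p)

/-- The ring homomorphism `W(k)[x] → W(k[x])` attached to the Frobenius lift. -/
noncomputable def sec : MvPolynomial σ (WittVector p k) →+* WittVector p (MvPolynomial σ k) :=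
  eval₂Hom (WittVector.map C) (fun j => WittVector.teichmuller p (X j))

end Defs

variable {p : ℕ} [Fact p.Prime] {σ k : Type*} [Field k]

theorem coeff_zero_sec (a : MvPolynomial σ (WittVector p k)) :
    (sec p σ k a).coeff 0 = red p σ k a := by
  have h : (WittVector.constantCoeff.comp (sec p σ k)) = red p σ k := by
    refine MvPolynomial.ringHom_ext (fun r => ?_) (fun j => ?_)
    · simp [sec, red]
    · simp [sec, red]
  exact RingHom.congr_fun h a

theorem red_surjective : Function.Surjective (red p σ k) :=
  map_surjective _ (WittVector.constantCoeff_surjective p)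

theorem witt_eq_teichmuller_add {R : Type*} [CommRing R] (w : WittVector p R) :
    ∃ w', w = WittVector.teichmuller p (w.coeff 0) + WittVector.verschiebung w' ∧
      ∀ i, w'.coeff i = w.coeff (i + 1) := by
  refine ⟨w.shift 1, ?_, fun i => by rw [WittVector.shift_coeff, add_comm]⟩
  ext i
  rw [WittVector.coeff_add_of_disjoint]
  · cases i with
    | zero => simp
    | succ i =>
      rw [WittVector.teichmuller_coeff_pos _ _ _ i.succ_pos, zero_add,
        WittVector.verschiebung_coeff_add_one, WittVector.shift_coeff, add_comm]
  · intro i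
    cases i with
    | zero => right; simp
    | succ i => left; exact WittVector.teichmuller_coeff_pos _ _ _ i.succ_pos

theorem exists_verschiebung {R : Type*} [CommRing R] {w : WittVector p R} (h : w.coeff 0 = 0) :
    ∃ w', w = WittVector.verschiebung w' := by
  obtain ⟨w', hw, -⟩ := witt_eq_teichmuller_add w
  exact ⟨w', by rw [hw, h, WittVector.teichmuller_zero, zero_add]⟩

theorem exists_eq_sec_add {w : WittVector p (MvPolynomial σ k)}
    {c : MvPolynomial σ (WittVector p k)} (h : red p σ k c = w.coeff 0) :
    ∃ w', w = sec p σ k c + WittVector.verschiebung w' := by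
  obtain ⟨w', hw'⟩ := exists_verschiebung (w := w - sec p σ k c) (by
    have : (WittVector.constantCoeff : WittVector p (MvPolynomial σ k) →+* _)
        (w - sec p σ k c) = 0 := by
      rw [map_sub, sub_eq_zero]
      exact (h.symm.trans (coeff_zero_sec c).symm)
    exact this)
  exact ⟨w', by rw [← hw']; ring⟩

theorem exists_sec_add (w : WittVector p (MvPolynomial σ k)) :
    ∃ c w', w = sec p σ k c + WittVector.verschiebung w' := by
  obtain ⟨c, hc⟩ := red_surjective (p := p) (w.coeff 0)
  exact ⟨c, exists_eq_sec_add hc⟩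

variable [CharP k p]

theorem frobenius_teichmuller {R : Type*} [CommRing R] [CharP R p] (f : R) :
    WittVector.frobenius (WittVector.teichmuller p f) = WittVector.teichmuller p f ^ p := by
  rw [WittVector.frobenius_eq_map_frobenius, WittVector.map_teichmuller, ← map_pow]
  rfl

/-- Both sides are ring homomorphisms, so the generators suffice. This compatibility makes `sec`
useful: F, V and p act on its image through φ. -/
theorem frobenius_sec (a : MvPolynomial σ (WittVector p k)) :
    WittVector.frobenius (sec p σ k a) = sec p σ k (frobLift p σ k a) := by
  have h : (WittVector.frobenius.comp (sec p σ k)) = (sec p σ k).comp (frobLift p σ k) := by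
    refine MvPolynomial.ringHom_ext (fun r => ?_) (fun j => ?_)
    · simp only [RingHom.comp_apply, sec, frobLift, coe_eval₂Hom, eval₂_C]
      ext1 i
      rw [WittVector.coeff_frobenius_charP, WittVector.map_coeff, WittVector.map_coeff,
        WittVector.coeff_frobenius_charP, map_pow]
    · simp only [RingHom.comp_apply, sec, frobLift, coe_eval₂Hom, eval₂_X, eval₂_pow,
        frobenius_teichmuller]
  exact RingHom.congr_fun h a

theorem red_frobLift (a : MvPolynomial σ (WittVector p k)) :
    red p σ k (frobLift p σ k a) = red p σ k a ^ p := by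
  rw [← coeff_zero_sec, ← frobenius_sec, WittVector.coeff_frobenius_charP, coeff_zero_sec]

theorem red_p : red p σ k p = 0 := by
  rw [map_natCast, CharP.cast_eq_zero]

theorem verschiebung_mul_sec (w : WittVector p (MvPolynomial σ k))
    (c : MvPolynomial σ (WittVector p k)) :
    WittVector.verschiebung w * sec p σ k c =
      WittVector.verschiebung (w * sec p σ k (frobLift p σ k c)) := by
  rw [← frobenius_sec, WittVector.verschiebung_mul_frobenius]

theorem verschiebung_sec_frobLift (c : MvPolynomial σ (WittVector p k)) :
    WittVector.verschiebung (sec p σ k (frobLift p σ k c)) = p * sec p σ k c := by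
  rw [← frobenius_sec, WittVector.verschiebung_frobenius, mul_comm]

theorem verschiebung_natCast_mul {R : Type*} [CommRing R] (w : WittVector p R) (n : ℕ) :
    WittVector.verschiebung ((n : WittVector p R) * w) =
      (n : WittVector p R) * WittVector.verschiebung w := by
  rw [← nsmul_eq_mul, map_nsmul, nsmul_eq_mul]

theorem verschiebung_mul_verschiebung {R : Type*} [CommRing R] (x y : WittVector p R) :
    WittVector.verschiebung x * WittVector.verschiebung y =
      p * WittVector.verschiebung (x * y) := by
  rw [← WittVector.verschiebung_mul_frobenius, WittVector.frobenius_verschiebung, ← mul_assoc,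
    mul_comm _ (p : WittVector p R), verschiebung_natCast_mul]

variable [IsAlgClosed k]

/-- As k is perfect, p generates the kernel of W(k) → k. -/
theorem dvd_of_red_eq_zero {a : MvPolynomial σ (WittVector p k)} (h : red p σ k a = 0) :
    ∃ e, a = p * e := by
  have h2 := (C_dvd_iff_map_hom_eq_zero (σ := σ) (WittVector.constantCoeff : WittVector p k →+* k)
    (p : WittVector p k) (fun r => by
      rw [← Ideal.mem_span_singleton, WittVector.mem_span_p_iff_coeff_zero_eq_zero]; rfl) a).2 h
  rwa [map_natCast] at h2

theorem exists_delta (a : MvPolynomial σ (WittVector p k)) :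
    ∃ D, a ^ p = frobLift p σ k a + p * D := by
  obtain ⟨D, hD⟩ := CYFamily.dvd_pow_sub_eval₂Hom p (WittVector.frobenius)
    (CYFamily.dvd_pow_sub_frobenius p) a
  exact ⟨D, by rw [← hD]; simp [frobLift]⟩

/-- The only ambiguity in w = sec(c) + V(w') is a shift of c by p e, which V(sec(φ(e))) = p sec(e)
transfers to w'. -/
theorem sec_add_verschiebung_inj {c c' : MvPolynomial σ (WittVector p k)}
    {w w' : WittVector p (MvPolynomial σ k)}
    (h : sec p σ k c + WittVector.verschiebung w = sec p σ k c' + WittVector.verschiebung w') :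
    red p σ k c = red p σ k c' ∧ ∃ e, w = w' + sec p σ k (frobLift p σ k e) := by
  have h0 : red p σ k c = red p σ k c' := by
    have := congrArg WittVector.constantCoeff h
    rw [map_add, map_add] at this
    simpa [coeff_zero_sec] using this
  refine ⟨h0, ?_⟩
  obtain ⟨e, he⟩ := dvd_of_red_eq_zero (a := c' - c) (by rw [map_sub, h0, sub_self])
  refine ⟨e, ?_⟩
  apply WittVector.verschiebung_injective
  rw [map_add, verschiebung_sec_frobLift, ← map_natCast (sec p σ k), ← map_mul, ← he, map_sub]
  linear_combination h

/-- `V(y²)` is divisible by `2` when `p = 2`. -/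
theorem two_dvd_verschiebung_pow (y : WittVector p (MvPolynomial σ k)) (hp : p = 2) :
    (p : WittVector p (MvPolynomial σ k)) ∣ WittVector.verschiebung (y ^ 2) := by
  obtain ⟨c, w, rfl⟩ := exists_sec_add y
  obtain ⟨D, hD⟩ := exists_delta c
  have h1 : (sec p σ k c + WittVector.verschiebung w) ^ 2 = sec p σ k (frobLift p σ k c) +
      p * (sec p σ k D + sec p σ k c * WittVector.verschiebung w +
        WittVector.verschiebung (w * w)) := by
    have h2 : sec p σ k c ^ 2 = sec p σ k (frobLift p σ k c) + p * sec p σ k D := by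
      have := congrArg (sec p σ k) hD
      rw [map_pow, map_add, map_mul, map_natCast] at this
      rw [← this]
      exact congrArg _ hp.symm
    have h3 := verschiebung_mul_verschiebung w w
    have h4 : (p : WittVector p (MvPolynomial σ k)) = 2 := by exact_mod_cast congrArg _ hp
    linear_combination h2 + h3 - h4 * sec p σ k c * WittVector.verschiebung w
  rw [h1, map_add, verschiebung_sec_frobLift, verschiebung_natCast_mul, ← mul_add]
  exact Dvd.intro _ rfl

/-- In the binomial expansion V(y)² = pV(y²) gives one factor p and the binomial coefficient
another. The last term V(y)^p has no such coefficient: for p odd V(y)³ already has two factors p,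
and p = 2 needs `two_dvd_verschiebung_pow`. -/
theorem sq_dvd_add_verschiebung_pow (T y : WittVector p (MvPolynomial σ k)) :
    (p : WittVector p (MvPolynomial σ k)) ^ 2 ∣ (T + WittVector.verschiebung y) ^ p - T ^ p -
      p * T ^ (p - 1) * WittVector.verschiebung y := by
  have hp : p.Prime := Fact.out
  have h2 : (p : WittVector p (MvPolynomial σ k)) ∣ WittVector.verschiebung y ^ 2 := by
    rw [sq, verschiebung_mul_verschiebung]
    exact Dvd.intro _ rfl
  obtain ⟨n, hn⟩ : ∃ n, p = n + 1 + 1 := ⟨p - 2, by have := hp.two_le; omega⟩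
  rw [add_pow, Finset.sum_range_succ]
  have hr : Finset.range p = Finset.range (n + 1 + 1) := by rw [hn]
  rw [hr, Finset.sum_range_succ]
  have e1 : p - (n + 1) = 1 := by omega
  have e2 : p - 1 = n + 1 := by omega
  have e3 : p.choose (n + 1) = p := by
    rw [← e2, Nat.choose_symm_of_eq_add (a := p - 1) (b := 1) (by omega), Nat.choose_one_right]
  rw [e1, e2, e3, Nat.sub_self, Nat.choose_self]
  have hsum : (p : WittVector p (MvPolynomial σ k)) ^ 2 ∣ ∑ x ∈ Finset.range (n + 1),
      T ^ x * WittVector.verschiebung y ^ (p - x) * (p.choose x : WittVector p _) := by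
    refine Finset.dvd_sum fun x hx => ?_
    have hx' : x < n + 1 := Finset.mem_range.1 hx
    rcases Nat.eq_zero_or_pos x with rfl | hpos
    · rw [pow_zero, one_mul, Nat.choose_zero_right, Nat.cast_one, mul_one, Nat.sub_zero]
      rcases hp.eq_two_or_odd with h | h
      · obtain ⟨z, hz⟩ := two_dvd_verschiebung_pow y h
        rw [show WittVector.verschiebung y ^ p = WittVector.verschiebung y ^ 2 from
          congrArg _ h, sq, sq, verschiebung_mul_verschiebung, ← sq y, hz, ← mul_assoc]
        exact Dvd.intro _ rfl
      · refine Dvd.dvd.trans ?_ (pow_dvd_pow _ (show 3 ≤ p by have := hp.two_le; omega))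
        rw [pow_succ _ 2, sq, sq, verschiebung_mul_verschiebung, mul_assoc,
          verschiebung_mul_verschiebung, ← mul_assoc]
        exact Dvd.intro _ rfl
    · rw [sq]
      refine mul_dvd_mul (Dvd.dvd.mul_left (h2.trans (pow_dvd_pow _ (by omega))) _) ?_
      exact Nat.cast_dvd_cast (hp.dvd_choose_self hpos.ne' (by omega))
  convert hsum using 1
  push_cast
  ring

/-- The recursion for the components of the Teichmüller lift `[f]` relative to `sec`. -/
theorem dvd_teichmuller_sub {f : MvPolynomial σ k} {F D : MvPolynomial σ (WittVector p k)}
    (hD : F ^ p = frobLift p σ k F + p * D) {y : WittVector p (MvPolynomial σ k)}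
    (hy : WittVector.teichmuller p f = sec p σ k F + WittVector.verschiebung y) :
    (p : WittVector p (MvPolynomial σ k)) ∣ y - sec p σ k D -
      WittVector.verschiebung (y * WittVector.teichmuller p f ^ (p * (p - 1))) := by
  -- Compute sec(F)^p = ([f] - V(y))^p modulo p² in two ways, using [f]^p = F([f]) = sec(φ(F)) + p
  -- y, then divide by p.
  obtain ⟨z, hz⟩ := sq_dvd_add_verschiebung_pow (WittVector.teichmuller p f) (-y)
  have h1 : WittVector.teichmuller p f ^ p =
      sec p σ k (frobLift p σ k F) + p * y := by
    rw [← frobenius_teichmuller, hy, map_add, frobenius_sec, WittVector.frobenius_verschiebung,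
      mul_comm y]
  have h2 := congrArg (sec p σ k) hD
  rw [map_pow, map_add, map_mul, map_natCast] at h2
  have h3 : WittVector.verschiebung (y * WittVector.teichmuller p f ^ (p * (p - 1))) =
      WittVector.verschiebung y * WittVector.teichmuller p f ^ (p - 1) := by
    rw [pow_mul, ← frobenius_teichmuller, ← map_pow, WittVector.verschiebung_mul_frobenius]
  have h4 : WittVector.teichmuller p f + WittVector.verschiebung (-y) = sec p σ k F := by
    rw [map_neg, hy]; ring
  rw [h4, map_neg] at hz
  refine ⟨-z, ?_⟩
  have hp0 : (p : WittVector p (MvPolynomial σ k)) ≠ 0 := WittVector.p_nonzero p _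
  apply mul_left_cancel₀ hp0
  rw [h3]
  linear_combination -h1 + h2 - hz

end WittSection

/-! ## Maps from Witt vectors to the base -/

namespace WittSection

open MvPolynomial

variable {p : ℕ} [Fact p.Prime] {σ k : Type*} [Field k] [CharP k p] [IsAlgClosed k]

local notation "𝔸" => MvPolynomial σ k
local notation "𝕎A" => WittVector p (MvPolynomial σ k)
local notation "𝔽" => WittVector.frobenius
local notation "𝕍" => WittVector.verschiebung
local notation "τ" => WittVector.teichmuller p

/-- Multipliers of the form c'^p c reach every intermediate stage, so the duality statement can be
applied i times. -/
theorem dvd_of_dvd_cartier_iterate [Fintype σ] {f X : 𝔸} (i : ℕ)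
    (h : ∀ c, f ∣ (cartier p)^[i] (c * X)) : f ^ p ^ i ∣ X := by
  induction i generalizing X with
  | zero => simpa using h 1
  | succ i ih =>
    rw [pow_succ, pow_mul]
    refine pow_dvd_of_dvd_cartier p fun c => ih fun c' => ?_
    have := h (c' ^ p * c)
    rwa [Function.iterate_succ_apply, mul_assoc, cartier_pow_mul] at this

/-- A system of `W(k)[x]`-linear maps `χ_i : W(A) → A` with `χ_i ∘ V = u ∘ χ_{i+1}`, where `u` is
the Cartier operator, vanishing for `i ≥ n`. Such systems describe the `W_n(A)`-linear maps
`F_* W_n(A) → A`, through `u ∘ χ_0`. -/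
structure IsSystem (p : ℕ) [Fact p.Prime] (σ k : Type*) [Field k] [CharP k p] [IsAlgClosed k]
    [Finite σ] (n : ℕ) (χ : ℕ → (WittVector p (MvPolynomial σ k) →+ MvPolynomial σ k)) :
    Prop where
  sec_mul : ∀ i c w, χ i (sec p σ k c * w) = red p σ k c * χ i w
  versch : ∀ i w, χ i (𝕍 w) = cartier p (χ (i + 1) w)
  eq_zero : ∀ i, n ≤ i → ∀ w, χ i w = 0

/-- The formula χ(sec(c) + V(w)) = c̄ g + u(χ'(w)) is forced. Shifting c by p e alters the second
term by u(ē^p χ'(1)) = ē u(χ'(1)), so `hu` is what makes it well defined. -/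
theorem exists_extend [Finite σ] (χ' : 𝕎A →+ 𝔸)
    (hlin : ∀ c w, χ' (sec p σ k c * w) = red p σ k c * χ' w) (hu : cartier p (χ' 1) = 0)
    (g : 𝔸) : ∃ χ : 𝕎A →+ 𝔸, (∀ c w, χ (sec p σ k c * w) = red p σ k c * χ w) ∧
      (∀ w, χ (𝕍 w) = cartier p (χ' w)) ∧ χ 1 = g := by
  choose c v hcv using fun w : 𝕎A => exists_sec_add w
  have key : ∀ a w, red p σ k (c (sec p σ k a + 𝕍 w)) * g +
      cartier p (χ' (v (sec p σ k a + 𝕍 w))) = red p σ k a * g + cartier p (χ' w) := by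
    intro a w
    obtain ⟨h1, e, he⟩ := sec_add_verschiebung_inj (hcv (sec p σ k a + 𝕍 w)).symm
    rw [h1, he, map_add, map_add, ← mul_one (sec p σ k (frobLift p σ k e)), hlin, red_frobLift,
      cartier_pow_mul, hu, mul_zero, add_zero]
  have key' : ∀ a w x, x = sec p σ k a + 𝕍 w → red p σ k (c x) * g + cartier p (χ' (v x)) =
      red p σ k a * g + cartier p (χ' w) := by
    rintro a w x rfl
    exact key a w
  refine ⟨⟨⟨fun w => red p σ k (c w) * g + cartier p (χ' (v w)), ?_⟩, ?_⟩, ?_, ?_, ?_⟩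
  · rw [key' 0 0 0 (by simp)]
    simp
  · intro x y
    change red p σ k (c (x + y)) * g + cartier p (χ' (v (x + y))) =
      red p σ k (c x) * g + cartier p (χ' (v x)) + (red p σ k (c y) * g + cartier p (χ' (v y)))
    rw [key' (c x + c y) (v x + v y) (x + y) (by
      rw [map_add, map_add]; linear_combination hcv x + hcv y)]
    simp only [map_add]
    ring
  · intro a w
    change red p σ k (c (sec p σ k a * w)) * g + cartier p (χ' (v (sec p σ k a * w))) =
      red p σ k a * (red p σ k (c w) * g + cartier p (χ' (v w)))
    rw [key' (a * c w) (sec p σ k (frobLift p σ k a) * v w) (sec p σ k a * w) (by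
      rw [map_mul, mul_comm _ (v w), ← verschiebung_mul_sec]
      linear_combination sec p σ k a * hcv w), hlin, red_frobLift, cartier_pow_mul, map_mul]
    ring
  · intro w
    change red p σ k (c (𝕍 w)) * g + cartier p (χ' (v (𝕍 w))) = _
    rw [key' 0 w _ (by simp), map_zero, zero_mul, zero_add]
  · change red p σ k (c 1) * g + cartier p (χ' (v 1)) = _
    rw [key' 1 0 1 (by simp)]
    simp

theorem exists_system [Finite σ] (n : ℕ) (g : ℕ → 𝔸) (hg : ∀ i, 1 ≤ i → cartier p (g i) = 0)
    (hz : ∀ i, n ≤ i → g i = 0) : ∃ χ : ℕ → (𝕎A →+ 𝔸), IsSystem p σ k n χ ∧ ∀ i, χ i 1 = g i := by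
  induction n generalizing g with
  | zero =>
    refine ⟨fun _ => 0, ⟨fun _ _ _ => ?_, fun _ _ => ?_, fun _ _ _ => rfl⟩, fun i => ?_⟩
    · simp
    · simp
    · simp [hz i (Nat.zero_le i)]
  | succ n ih =>
    obtain ⟨χ', h1, h2⟩ := ih (fun i => g (i + 1)) (fun i _ => hg _ (by omega))
      (fun i hi => hz _ (by omega))
    obtain ⟨χ₀, h3, h4, h5⟩ := exists_extend (χ' 0) (h1.sec_mul 0)
      (by rw [h2]; exact hg _ le_rfl) (g 0)
    refine ⟨fun i => Nat.casesOn i χ₀ χ', ⟨fun i => ?_, fun i => ?_, fun i hi => ?_⟩,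
      fun i => ?_⟩
    · cases i with
      | zero => exact h3
      | succ i => exact h1.sec_mul i
    · cases i with
      | zero => exact h4
      | succ i => exact h1.versch i
    · cases i with
      | zero => omega
      | succ i => exact h1.eq_zero i (by omega)
    · cases i with
      | zero => exact h5
      | succ i => exact h2 i

/-- H kills multiples of p, so for fixed w the map a ↦ H(sec(ã) w) depends only on a and is
p⁻¹-linear; hence it is u(a g) for a unique g, which is taken as χ(w). Uniqueness of g yields
additivity and linearity. -/
theorem exists_eq_cartier_comp [Fintype σ] (H : 𝕎A →+ 𝔸)
    (hH : ∀ c w, H (𝔽 (sec p σ k c) * w) = red p σ k c * H w) :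
    ∃ χ : 𝕎A →+ 𝔸, (∀ c w, χ (sec p σ k c * w) = red p σ k c * χ w) ∧
      ∀ w, H w = cartier p (χ w) := by
  have hp0 : ∀ w, H (p * w) = 0 := fun w => by
    have := hH p w
    rwa [map_natCast (sec p σ k), map_natCast, red_p, zero_mul] at this
  choose l hl using red_surjective (p := p) (σ := σ) (k := k)
  have hwd : ∀ c c' w, red p σ k c = red p σ k c' → H (sec p σ k c * w) = H (sec p σ k c' * w) := by
    intro c c' w h
    obtain ⟨e, he⟩ := dvd_of_red_eq_zero (a := c - c') (by rw [map_sub, h, sub_self])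
    have h1 : sec p σ k c = sec p σ k c' + p * sec p σ k e := by
      rw [← map_natCast (sec p σ k), ← map_mul, ← he, map_sub]; ring
    rw [h1, add_mul, map_add, mul_assoc, hp0, add_zero]
  have hdual : ∀ w, ∃ g, ∀ a, H (sec p σ k (l a) * w) = cartier p (a * g) := by
    intro w
    refine exists_eq_cartier_mul p ⟨⟨fun a => H (sec p σ k (l a) * w), ?_⟩, ?_⟩ ?_
    · rw [hwd (l 0) 0 w (by rw [hl, map_zero])]
      simp
    · intro a b
      change H (sec p σ k (l (a + b)) * w) = H (sec p σ k (l a) * w) + H (sec p σ k (l b) * w)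
      rw [hwd (l (a + b)) (l a + l b) w (by rw [map_add, hl, hl, hl]), map_add, add_mul, map_add]
    · intro a b
      change H (sec p σ k (l (a ^ p * b)) * w) = a * H (sec p σ k (l b) * w)
      rw [hwd (l (a ^ p * b)) (frobLift p σ k (l a) * l b) w
        (by rw [map_mul, red_frobLift, hl, hl, hl]), map_mul (sec p σ k), ← frobenius_sec,
        mul_assoc, hH, hl]
  choose χ hχ using hdual
  have hχ' : ∀ c w, H (sec p σ k c * w) = cartier p (red p σ k c * χ w) := fun c w => by
    rw [← hχ, hwd]
    rw [hl]
  have huniq : ∀ w g, (∀ c, H (sec p σ k c * w) = cartier p (red p σ k c * g)) → χ w = g := by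
    intro w g h
    refine eq_of_cartier_mul_eq p fun a => ?_
    obtain ⟨c, rfl⟩ := red_surjective (p := p) a
    rw [← hχ', h]
  refine ⟨⟨⟨χ, ?_⟩, ?_⟩, ?_, ?_⟩
  · refine huniq _ _ fun c => ?_
    simp
  · intro x y
    refine huniq _ _ fun c => ?_
    rw [mul_add, map_add, hχ', hχ', mul_add, map_add]
  · intro c w
    refine huniq _ _ fun c' => ?_
    change _ = cartier p (red p σ k c' * (red p σ k c * χ w))
    rw [← mul_assoc, ← map_mul (sec p σ k), hχ', map_mul (red p σ k), mul_assoc]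
  · intro w
    have := hχ' 1 w
    rwa [map_one, one_mul, map_one, one_mul] at this

/-- Every `W_n(A)`-linear map `F_* W_n(A) → A` comes from a system. -/
theorem exists_system_of_linear [Fintype σ] (n : ℕ) (ψ : 𝕎A →+ 𝔸)
    (hψ : ∀ x : 𝕎A, (∀ i < n, x.coeff i = 0) → ψ x = 0)
    (hlin : ∀ a x : 𝕎A, ψ (𝔽 a * x) = a.coeff 0 * ψ x) :
    ∃ χ : ℕ → (𝕎A →+ 𝔸), IsSystem p σ k n χ ∧ ∀ w, ψ w = cartier p (χ 0 w) := by
  let T := {χ : 𝕎A →+ 𝔸 // ∀ c w, χ (sec p σ k c * w) = red p σ k c * χ w}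
  -- By V(F(c) w) = c V(w), composing with V gives again a p⁻¹-linear map, so the factorisation
  -- through u can be repeated.
  have hnext : ∀ χ : T, ∃ χ' : T, ∀ w, χ.1 (𝕍 w) = cartier p (χ'.1 w) := by
    intro χ
    obtain ⟨χ', h1, h2⟩ := exists_eq_cartier_comp (χ.1.comp (𝕍 : 𝕎A →+ 𝕎A)) (by
      intro c w
      change χ.1 (𝕍 _) = _ * χ.1 (𝕍 w)
      rw [mul_comm, WittVector.verschiebung_mul_frobenius, mul_comm, χ.2])
    exact ⟨⟨χ', h1⟩, h2⟩
  choose next hnext using hnext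
  obtain ⟨χ₀, h1, h2⟩ := exists_eq_cartier_comp ψ (by
    intro c w
    rw [hlin, coeff_zero_sec])
  let S : ℕ → T := fun i => Nat.rec ⟨χ₀, h1⟩ (fun _ χ => next χ) i
  have hV : ∀ i w, (S i).1 (𝕍 w) = cartier p ((S (i + 1)).1 w) := fun i w => hnext (S i) w
  -- ψ kills V^n; each further index i trades one V for one u, and u(c ·) for all c detects zero.
  have hzero : ∀ i j w, n ≤ i + j → (S i).1 (𝕍^[j] w) = 0 := by
    intro i
    induction i with
    | zero =>
      intro j w hj
      refine eq_of_cartier_mul_eq p fun a => ?_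
      obtain ⟨c, rfl⟩ := red_surjective (p := p) a
      rw [← (S 0).2]
      change cartier p (χ₀ _) = _
      rw [← h2, mul_comm, WittVector.iterate_verschiebung_mul_left, mul_zero, map_zero]
      refine hψ _ fun i hi => ?_
      exact WittVector.iterate_verschiebung_coeff_eq_zero _ (by omega)
    | succ i ih =>
      intro j w hj
      refine eq_of_cartier_mul_eq p fun a => ?_
      obtain ⟨c, rfl⟩ := red_surjective (p := p) a
      rw [← (S (i + 1)).2, ← hV, mul_comm, WittVector.iterate_verschiebung_mul_left, mul_zero,
        map_zero, ← Function.iterate_succ_apply' 𝕍]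
      exact ih _ _ (by omega)
  exact ⟨fun i => (S i).1, ⟨fun i => (S i).2, hV, fun i hi w => hzero i 0 w hi⟩, h2⟩

/-! ### Values and divisibility properties of a system -/

namespace IsSystem

variable {n : ℕ} {χ : ℕ → (WittVector p (MvPolynomial σ k) →+ MvPolynomial σ k)} [Finite σ]

theorem apply_sec (hχ : IsSystem p σ k n χ) (i : ℕ) (c : MvPolynomial σ (WittVector p k)) :
    χ i (sec p σ k c) = red p σ k c * χ i 1 := by
  rw [← hχ.sec_mul, mul_one]

theorem p_mul (hχ : IsSystem p σ k n χ) (i : ℕ) (w : 𝕎A) : χ i (p * w) = 0 := by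
  rw [← map_natCast (sec p σ k), hχ.sec_mul, red_p, zero_mul]

theorem apply_eq_of_dvd (hχ : IsSystem p σ k n χ) {i : ℕ} {x y : 𝕎A} (h : (p : 𝕎A) ∣ x - y) : χ i x = χ i y := by
  obtain ⟨z, hz⟩ := h
  rw [← sub_eq_zero, ← map_sub, hz, hχ.p_mul]

/-- V(1) = p, and χ_i kills p. This is the only constraint on the values at 1. -/
theorem cartier_apply_one (hχ : IsSystem p σ k n χ) (i : ℕ) : cartier p (χ (i + 1) 1) = 0 := by
  rw [← hχ.versch, ← mul_one (𝕍 1)]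
  have : (𝕍 1 : 𝕎A) = p * 1 := by
    rw [← map_one (𝔽 : 𝕎A →+* 𝕎A), WittVector.verschiebung_frobenius, map_one, one_mul, mul_one]
  rw [this, mul_assoc, hχ.p_mul]

theorem iterate_versch (hχ : IsSystem p σ k n χ) (i j : ℕ) (w : 𝕎A) :
    χ i (𝕍^[j] w) = (cartier p)^[j] (χ (i + j) w) := by
  induction j generalizing i with
  | zero => rfl
  | succ j ih =>
    rw [Function.iterate_succ_apply', hχ.versch, ih, Function.iterate_succ_apply',
      show i + 1 + j = i + (j + 1) by ring]

theorem eq_zero_of_coeff (hχ : IsSystem p σ k n χ) {w : 𝕎A} (h : ∀ i < n, w.coeff i = 0) : χ 0 w = 0 := by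
  rw [WittVector.eq_iterate_verschiebung h, hχ.iterate_versch, zero_add, hχ.eq_zero n le_rfl,
    iterate_map_zero]

theorem pow_p_mul_versch (hχ : IsSystem p σ k n χ) (i : ℕ) (f : 𝔸) (w : 𝕎A) (m : ℕ) :
    χ i (τ f ^ m * 𝕍 w) = cartier p (χ (i + 1) (τ f ^ (p * m) * w)) := by
  have h : τ f ^ (p * m) = 𝔽 (τ f ^ m) := by rw [map_pow, frobenius_teichmuller, pow_mul]
  rw [h, mul_comm, mul_comm _ w, ← hχ.versch, WittVector.verschiebung_mul_frobenius]

/-- Linearity over `sec` suffices: the remaining part V(w) of a has Frobenius p w, which is killed.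
-/
theorem cartier_linear (hχ : IsSystem p σ k n χ) (x a : 𝕎A) :
    cartier p (χ 0 (𝔽 a * x)) = a.coeff 0 * cartier p (χ 0 x) := by
  obtain ⟨c, w, rfl⟩ := exists_sec_add a
  have h0 : (sec p σ k c + 𝕍 w).coeff 0 = red p σ k c := by
    have : (WittVector.constantCoeff : 𝕎A →+* 𝔸) (sec p σ k c + 𝕍 w) = red p σ k c := by
      rw [map_add]; simp [coeff_zero_sec]
    exact this
  rw [h0, map_add, add_mul, map_add, frobenius_sec, hχ.sec_mul, WittVector.frobenius_verschiebung,
    mul_comm w, mul_assoc, hχ.p_mul, add_zero, red_frobLift, cartier_pow_mul]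

/-- Divisibility of `χ_l([f]² w)`. -/
theorem dvd_apply_sq_mul (hχ : IsSystem p σ k n χ) {f : 𝔸} {i : ℕ} (hg : ∀ l, i ≤ l → f ^ p ^ (l + 1) ∣ f ^ 2 * χ l 1)
    (l : ℕ) (hl : i ≤ l) (w : 𝕎A) : f ^ p ^ (l + 1) ∣ χ l (τ f ^ 2 * w) := by
  have hp : p.Prime := Fact.out
  obtain ⟨j, hj⟩ : ∃ j, n ≤ l + j := ⟨n, by omega⟩
  -- Descending induction on l, starting where the system vanishes.
  induction j generalizing l w with
  | zero => rw [hχ.eq_zero l hj]; exact dvd_zero _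
  | succ j ih =>
    have ih' : ∀ m w, 2 ≤ m → f ^ p ^ (l + 1) ∣ cartier p (χ (l + 1) (τ f ^ m * w)) := by
      intro m w hm
      apply pow_dvd_cartier
      rw [← pow_succ', show τ f ^ m = τ f ^ 2 * τ f ^ (m - 2) by
        rw [← pow_add]; congr 1; omega, mul_assoc]
      exact ih (l + 1) (by omega) _ (by omega)
    obtain ⟨F, hF⟩ := red_surjective (p := p) f
    obtain ⟨y, hy⟩ := exists_eq_sec_add (w := τ f) (c := F)
      (by rw [hF, WittVector.teichmuller_coeff_zero])
    obtain ⟨c, w', rfl⟩ := exists_sec_add w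
    -- Writing the cross term with [f] rather than sec(F) lets [f]V(y) = V([f]^p y), and p ≥ 2 puts
    -- a square of [f] at level l+1.
    have hsq : τ f ^ 2 = sec p σ k (F ^ 2) + 2 * (τ f ^ 1 * 𝕍 y) - p * 𝕍 (y * y) := by
      rw [← verschiebung_mul_verschiebung, map_pow]
      linear_combination (τ f + sec p σ k F - 𝕍 y) * hy
    have h1 : τ f ^ 2 * (sec p σ k c + 𝕍 w') = sec p σ k c * (sec p σ k (F ^ 2) +
        2 * (τ f ^ 1 * 𝕍 y) - p * 𝕍 (y * y)) + τ f ^ 2 * 𝕍 w' := by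
      rw [← hsq]; ring
    rw [h1, map_add, hχ.pow_p_mul_versch]
    refine dvd_add ?_ (ih' _ _ (by have := hp.two_le; omega))
    rw [hχ.sec_mul, map_sub, map_add, hχ.p_mul, sub_zero, hχ.apply_sec, map_pow, hF, two_mul,
      map_add, hχ.pow_p_mul_versch]
    refine Dvd.dvd.mul_left ?_ _
    have := ih' (p * 1) y (by have := hp.two_le; omega)
    exact dvd_add (hg l hl) (dvd_add this this)

/-- Insert the recursion for the components of [f] twice. The remainder is u²(χ_{i+2}([f]^{p(p-1)}
y)); since p(p-1) ≥ 2 it falls under `h2`, and each u takes a p-th root of the power of f. -/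
theorem dvd_apply_mul_sec_sub (hχ : IsSystem p σ k n χ) {f : 𝔸} {F D : MvPolynomial σ (WittVector p k)}
    (hF : red p σ k F = f) (hD : F ^ p = frobLift p σ k F + p * D) {i : ℕ}
    (h2 : ∀ w, f ^ p ^ (i + 3) ∣ χ (i + 2) (τ f ^ 2 * w)) (c : MvPolynomial σ (WittVector p k)) :
    f ^ p ^ (i + 1) ∣ χ i (τ f * sec p σ k c) -
      red p σ k c * (f * χ i 1 + cartier p (red p σ k D * χ (i + 1) 1)) := by
  have hp : p.Prime := Fact.out
  obtain ⟨y, hy⟩ := exists_eq_sec_add (w := τ f) (c := F)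
    (by rw [hF, WittVector.teichmuller_coeff_zero])
  have hy2 := dvd_teichmuller_sub hD hy
  have h3 : χ (i + 1) y = red p σ k D * χ (i + 1) 1 +
      cartier p (χ (i + 2) (τ f ^ (p * (p - 1)) * y)) := by
    rw [mul_comm _ y, ← hχ.versch, ← hχ.apply_sec, ← map_add]
    exact hχ.apply_eq_of_dvd (by rwa [← sub_sub])
  rw [mul_comm, hχ.sec_mul, ← mul_sub]
  refine Dvd.dvd.mul_left ?_ _
  have h4 : χ i (τ f) = f * χ i 1 + cartier p (red p σ k D * χ (i + 1) 1) +
      cartier p (cartier p (χ (i + 2) (τ f ^ (p * (p - 1)) * y))) := by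
    conv_lhs => rw [hy]
    rw [map_add, hχ.apply_sec, hF, hχ.versch, h3, map_add, add_assoc]
  rw [h4, add_sub_cancel_left]
  apply pow_dvd_cartier
  rw [← pow_succ']
  apply pow_dvd_cartier
  rw [← pow_succ']
  have h5 : 2 ≤ p * (p - 1) := by
    have := hp.two_le
    calc 2 = 2 * 1 := rfl
      _ ≤ p * (p - 1) := Nat.mul_le_mul this (by omega)
  rw [show τ f ^ (p * (p - 1)) = τ f ^ 2 * τ f ^ (p * (p - 1) - 2) by
        rw [← pow_add]; congr 1; omega, mul_assoc]
  exact h2 _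

end IsSystem

/-- The operator `h ↦ -u(f^{p-2} Δ h)`. -/
noncomputable def theta [Finite σ] (f Δ : 𝔸) : 𝔸 →+ 𝔸 where
  toFun h := -cartier p (f ^ (p - 2) * Δ * h)
  map_zero' := by simp
  map_add' a b := by rw [mul_add, map_add, neg_add]

theorem theta_apply [Finite σ] (f Δ h : 𝔸) :
    theta (p := p) f Δ h = -cartier p (f ^ (p - 2) * Δ * h) := rfl

theorem cartier_mul_pow_sub_two [Finite σ] (f x y : 𝔸) (i : ℕ) :
    cartier p (x * (f ^ (p ^ (i + 1) - 2) * y)) =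
      f ^ (p ^ i - 1) * cartier p (f ^ (p - 2) * x * y) := by
  have hp : 2 ≤ p := (Fact.out : p.Prime).two_le
  have h1 : p ^ (i + 1) - 2 = p * (p ^ i - 1) + (p - 2) := by
    have h2 : 1 ≤ p ^ i := Nat.one_le_pow _ _ (by omega)
    rw [pow_succ', Nat.mul_sub, mul_one]
    have := Nat.mul_le_mul_left p h2
    omega
  rw [← cartier_pow_mul, h1, pow_add, ← pow_mul, mul_comm p]
  congr 1
  ring

theorem pow_sub_one_mul_theta [Finite σ] (f Δ h : 𝔸) (i : ℕ) :
    cartier p (Δ * (f ^ (p ^ (i + 1) - 2) * h)) = -(f ^ (p ^ i - 1) * theta (p := p) f Δ h) := by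
  rw [cartier_mul_pow_sub_two, theta_apply, mul_neg, neg_neg]

theorem two_le_pow (p : ℕ) [Fact p.Prime] (i : ℕ) : 2 ≤ p ^ (i + 1) :=
  (Fact.out : p.Prime).two_le.trans (Nat.le_self_pow i.succ_ne_zero p)

/-! ### Divisibility of a system as a recursion under θ -/

namespace IsSystem

variable {n : ℕ} {χ : ℕ → (WittVector p (MvPolynomial σ k) →+ MvPolynomial σ k)} [Finite σ]
  {f : MvPolynomial σ k} {F D : MvPolynomial σ (WittVector p k)}

/-- Only the part sec(c) of w imposes a condition: [f]V(w') = V([f]^p w') is already covered by the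
divisibility at [f]². -/
theorem dvd_apply_mul_iff (hχ : IsSystem p σ k n χ) (hF : red p σ k F = f)
    (hD : F ^ p = frobLift p σ k F + p * D) {i : ℕ}
    (hg : ∀ l, i + 1 ≤ l → f ^ (p ^ (l + 1) - 2) ∣ χ l 1) :
    (∀ w, f ^ p ^ (i + 1) ∣ χ i (τ f * w)) ↔
      f ^ p ^ (i + 1) ∣ f * χ i 1 + cartier p (red p σ k D * χ (i + 1) 1) := by
  have hp : p.Prime := Fact.out
  have hsq : ∀ l, i + 1 ≤ l → ∀ w, f ^ p ^ (l + 1) ∣ χ l (τ f ^ 2 * w) := by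
    refine hχ.dvd_apply_sq_mul fun l hl => ?_
    obtain ⟨c, hc⟩ := hg l hl
    rw [hc, ← mul_assoc, ← pow_add, Nat.add_sub_cancel' (two_le_pow p l)]
    exact Dvd.intro _ rfl
  have hsub := hχ.dvd_apply_mul_sec_sub hF hD (hsq (i + 2) (by omega))
  constructor
  · intro h
    have h1 := hsub 1
    rw [map_one, map_one, one_mul] at h1
    exact (dvd_sub_right (h 1)).1 h1
  · intro h w
    obtain ⟨c, w', rfl⟩ := exists_sec_add w
    rw [mul_add, map_add]
    refine dvd_add ?_ ?_
    · rw [← sub_add_cancel (χ i (τ f * sec p σ k c)) (red p σ k c * (f * χ i 1 +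
        cartier p (red p σ k D * χ (i + 1) 1)))]
      exact dvd_add (hsub c) (Dvd.dvd.mul_left h _)
    · have := hχ.pow_p_mul_versch i f w' 1
      rw [pow_one] at this
      rw [this]
      apply pow_dvd_cartier
      rw [← pow_succ', show τ f ^ (p * 1) = τ f ^ 2 * τ f ^ (p - 2) by
        rw [← pow_add]; congr 1; have := hp.two_le; omega, mul_assoc]
      exact hsq _ le_rfl _

/-- The divisibility properties of a system built from a sequence `h` with `h_i = θ(h_{i+1})`. -/
theorem dvd_of_theta (hχ : IsSystem p σ k n χ) (hF : red p σ k F = f)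
    (hD : F ^ p = frobLift p σ k F + p * D) {h : ℕ → MvPolynomial σ k}
    (hg : ∀ i < n, χ i 1 = f ^ (p ^ (i + 1) - 2) * h i)
    (hh : ∀ i, i + 1 < n → h i = theta (p := p) f (red p σ k D) (h (i + 1))) :
    (∀ i w, f ^ p ^ (i + 1) ∣ χ i (τ f ^ 2 * w)) ∧
      ∀ i, i + 1 < n → ∀ w, f ^ p ^ (i + 1) ∣ χ i (τ f * w) := by
  have hg' : ∀ l, f ^ (p ^ (l + 1) - 2) ∣ χ l 1 := by
    intro l
    rcases lt_or_ge l n with hl | hl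
    · rw [hg l hl]; exact Dvd.intro _ rfl
    · rw [hχ.eq_zero l hl]; exact dvd_zero _
  refine ⟨fun i => hχ.dvd_apply_sq_mul (i := 0) (fun l _ => ?_) i (Nat.zero_le i), fun i hi => ?_⟩
  · obtain ⟨c, hc⟩ := hg' l
    rw [hc, ← mul_assoc, ← pow_add, Nat.add_sub_cancel' (two_le_pow p l)]
    exact Dvd.intro _ rfl
  · rw [hχ.dvd_apply_mul_iff hF hD fun l _ => hg' l, hg (i + 1) hi, pow_sub_one_mul_theta,
      ← hh i hi, hg i (by omega), ← mul_assoc, ← pow_succ',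
      show p ^ (i + 1) - 2 + 1 = p ^ (i + 1) - 1 by have := two_le_pow p i; omega, add_neg_cancel]
    exact dvd_zero _

/-- The sequence `h` attached to a system with the divisibility properties. -/
theorem exists_theta (hχ : IsSystem p σ k n χ) (hf : f ≠ 0) (hF : red p σ k F = f)
    (hD : F ^ p = frobLift p σ k F + p * D)
    (h1 : ∀ i, i + 1 < n → ∀ w, f ^ p ^ (i + 1) ∣ χ i (τ f * w))
    (h2 : ∀ i, i + 1 = n → ∀ w, f ^ p ^ (i + 1) ∣ χ i (τ f ^ 2 * w)) :
    ∃ h : ℕ → MvPolynomial σ k, (∀ i, χ i 1 = f ^ (p ^ (i + 1) - 2) * h i) ∧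
      ∀ i, i + 1 < n → f ∣ h i - theta (p := p) f (red p σ k D) (h (i + 1)) := by
  -- Descending induction: the top index uses the condition on [f]², lower ones the condition on
  -- [f], where u(Δ g_{i+1}) is divisible by f^{p^{i+1}-1}.
  have hdvd : ∀ j i, n ≤ i + j → f ^ (p ^ (i + 1) - 2) ∣ χ i 1 := by
    intro j
    induction j with
    | zero =>
      intro i hi
      rw [hχ.eq_zero i hi]
      exact dvd_zero _
    | succ j ih =>
      intro i hi
      have h2le := two_le_pow p i
      rcases lt_trichotomy (i + 1) n with hin | hin | hin
      · have h3 := (hχ.dvd_apply_mul_iff hF hD fun l hl => ih l (by omega)).1 (h1 i hin)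
        obtain ⟨h', hh'⟩ := ih (i + 1) (by omega)
        rw [hh', pow_sub_one_mul_theta] at h3
        have h4 : f ^ (p ^ (i + 1) - 1) ∣ f * χ i 1 := by
          have h5 := dvd_add ((pow_dvd_pow f (Nat.sub_le _ 1)).trans h3)
            (Dvd.intro (theta (p := p) f (red p σ k D) h') rfl)
          rwa [neg_add_cancel_right] at h5
        rwa [show p ^ (i + 1) - 1 = p ^ (i + 1) - 2 + 1 by omega, pow_succ',
          mul_dvd_mul_iff_left hf] at h4
      · have h3 := h2 i hin 1
        obtain ⟨w', hw'⟩ := exists_eq_sec_add (w := τ f ^ 2) (c := F ^ 2) (by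
          rw [← map_pow, WittVector.teichmuller_coeff_zero, map_pow, hF])
        rw [mul_one, hw', map_add, hχ.versch, hχ.eq_zero (i + 1) hin.ge, map_zero, add_zero,
          hχ.apply_sec, map_pow, hF] at h3
        rwa [show p ^ (i + 1) = 2 + (p ^ (i + 1) - 2) by omega, pow_add,
          mul_dvd_mul_iff_left (pow_ne_zero 2 hf)] at h3
      · exact ih i (by omega)
  choose h hh using fun i => hdvd n i (by omega)
  refine ⟨h, hh, fun i hi => ?_⟩
  have h3 := (hχ.dvd_apply_mul_iff hF hD fun l _ => hdvd n l (by omega)).1 (h1 i hi)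
  have h2le := two_le_pow p i
  rw [hh (i + 1), pow_sub_one_mul_theta, hh i, ← mul_assoc, ← pow_succ',
    show p ^ (i + 1) - 2 + 1 = p ^ (i + 1) - 1 by omega, ← sub_eq_add_neg, ← mul_sub] at h3
  rw [show p ^ (i + 1) = p ^ (i + 1) - 1 + 1 by omega, pow_succ, Nat.add_sub_cancel] at h3
  exact (mul_dvd_mul_iff_left (pow_ne_zero _ hf)).1 h3

end IsSystem

end WittSection

/-! ## Divisors and splittings of pairs -/

section Divisors

variable {A : Type*} [CommRing A] [IsDomain A] [UniqueFactorizationMonoid A]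

theorem dvd_iff_multiplicity_le {a b : A} (ha : a ≠ 0) (hb : b ≠ 0) :
    a ∣ b ↔ ∀ π : A, Prime π → multiplicity π a ≤ multiplicity π b := by
  rw [UniqueFactorizationMonoid.dvd_iff_emultiplicity_le ha]
  refine forall₂_congr fun π hπ => ?_
  rw [(FiniteMultiplicity.of_prime_left hπ ha).emultiplicity_eq_multiplicity,
    (FiniteMultiplicity.of_prime_left hπ hb).emultiplicity_eq_multiplicity, Nat.cast_le]

theorem multiplicity_mul_of_prime {π a b : A} (hπ : Prime π) (ha : a ≠ 0) (hb : b ≠ 0) :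
    multiplicity π (a * b) = multiplicity π a + multiplicity π b :=
  multiplicity_mul hπ (FiniteMultiplicity.of_prime_left hπ (mul_ne_zero ha hb))

theorem multiplicity_pow_of_prime {π a : A} (hπ : Prime π) (ha : a ≠ 0) (n : ℕ) :
    multiplicity π (a ^ n) = n * multiplicity π a :=
  FiniteMultiplicity.multiplicity_pow hπ (FiniteMultiplicity.of_prime_left hπ ha)

/-- Sections of `A(p^{i+1} (1 - 2 / p^n) div f)`. -/
theorem mem_divisorSections_iff (p : ℕ) (hp : 0 < p) {n i : ℕ} (hi : i < n) {f : A} (hf : f ≠ 0)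
    (a : FractionRing A) :
    a ∈ divisorSections (fun π : A =>
      (p : ℚ) ^ i * (p * ((1 - 2 / (p : ℚ) ^ n) * (multiplicity π f : ℚ)))) ↔
    ∃ y : A, algebraMap A (FractionRing A) y = a * algebraMap A (FractionRing A) f ^ p ^ (i + 1) ∧
      f ^ 2 ∣ y ^ p ^ (n - 1 - i) := by
  rcases eq_or_ne a 0 with rfl | ha
  · refine ⟨fun _ => ⟨0, by simp, ?_⟩, fun _ => Or.inl rfl⟩
    rw [zero_pow (pow_pos hp _).ne']
    exact dvd_zero _
  set u := IsFractionRing.num A a with hu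
  set v : A := (IsFractionRing.den A a : A) with hv
  have hv0 : v ≠ 0 := nonZeroDivisors.ne_zero (IsFractionRing.den A a).2
  have hinj := IsFractionRing.injective A (FractionRing A)
  have huv : algebraMap A (FractionRing A) u = a * algebraMap A (FractionRing A) v := by
    have h := IsFractionRing.mk'_num_den A a
    rw [IsLocalization.mk'_eq_iff_eq_mul] at h
    exact h
  have hu0 : u ≠ 0 := by
    intro h
    rw [h, map_zero, eq_comm, mul_eq_zero] at huv
    exact huv.elim ha fun h' => hv0 (hinj (by rw [h', map_zero]))
  have hpn : (0 : ℚ) < (p : ℚ) ^ n := by positivity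
  have hpow : (p : ℚ) ^ n = (p : ℚ) ^ (i + 1) * (p : ℚ) ^ (n - 1 - i) := by
    rw [← pow_add]; congr 1; omega
  have hpi : (0 : ℚ) < (p : ℚ) ^ (n - 1 - i) := by positivity
  have hcoef : ∀ m : ℕ, (p : ℚ) ^ i * (p * ((1 - 2 / (p : ℚ) ^ n) * (m : ℚ))) =
      (p : ℚ) ^ (i + 1) * m - 2 * m / (p : ℚ) ^ (n - 1 - i) := by
    intro m
    rw [hpow]
    field_simp
    ring
  -- Clear the floor and the denominator p^{n-1-i} to obtain an inequality between natural numbers.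
  have hord : ∀ π : A, (0 ≤ ordAlong π a + ⌊(p : ℚ) ^ i * (p * ((1 - 2 / (p : ℚ) ^ n) *
      (multiplicity π f : ℚ)))⌋) ↔ 2 * multiplicity π f + p ^ (n - 1 - i) * multiplicity π v ≤
        p ^ (n - 1 - i) * (multiplicity π u + p ^ (i + 1) * multiplicity π f) := by
    intro π
    rw [← neg_le_iff_add_nonneg', Int.le_floor, hcoef]
    change ((-((multiplicity π u : ℤ) - (multiplicity π v : ℤ)) : ℤ) : ℚ) ≤ _ ↔ _
    rw [le_sub_iff_add_le, ← sub_nonneg, ← mul_nonneg_iff_of_pos_left hpi,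
      ← @Nat.cast_le ℚ, ← sub_nonneg (b := ((2 * multiplicity π f + _ : ℕ) : ℚ))]
    push_cast
    apply iff_of_eq
    congr 1
    field_simp
    ring
  have hf1 : f ^ p ^ (i + 1) ≠ 0 := pow_ne_zero _ hf
  constructor
  · rintro (h | h)
    · exact absurd h ha
    have h' := fun π hπ => (hord π).1 (h π hπ)
    have hdvd : v ∣ u * f ^ p ^ (i + 1) := by
      rw [dvd_iff_multiplicity_le hv0 (mul_ne_zero hu0 hf1)]
      intro π hπ
      rw [multiplicity_mul_of_prime hπ hu0 hf1, multiplicity_pow_of_prime hπ hf]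
      exact Nat.le_of_mul_le_mul_left ((Nat.le_add_left _ _).trans (h' π hπ)) (pow_pos hp _)
    obtain ⟨y, hy⟩ := hdvd
    have hy0 : y ≠ 0 := by
      rintro rfl
      rw [mul_zero] at hy
      exact mul_ne_zero hu0 hf1 hy
    refine ⟨y, ?_, ?_⟩
    · have hv1 : algebraMap A (FractionRing A) v ≠ 0 := fun h0 => hv0 (hinj (by rw [h0, map_zero]))
      apply mul_left_cancel₀ hv1
      rw [← map_mul, ← hy, map_mul, huv, map_pow]
      ring
    · rw [dvd_iff_multiplicity_le (pow_ne_zero _ hf) (pow_ne_zero _ hy0)]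
      intro π hπ
      rw [multiplicity_pow_of_prime hπ hf, multiplicity_pow_of_prime hπ hy0]
      have h1 := congrArg (multiplicity π) hy
      rw [multiplicity_mul_of_prime hπ hu0 hf1, multiplicity_pow_of_prime hπ hf,
        multiplicity_mul_of_prime hπ hv0 hy0] at h1
      have h2 := h' π hπ
      rw [h1, mul_add] at h2
      omega
  · rintro ⟨y, hy, hdvd⟩
    refine Or.inr fun π hπ => (hord π).2 ?_
    have hy' : u * f ^ p ^ (i + 1) = v * y := by
      apply hinj
      rw [map_mul, map_mul, hy, huv, map_pow]
      ring
    have hy0 : y ≠ 0 := by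
      rintro rfl
      rw [mul_zero] at hy'
      exact mul_ne_zero hu0 hf1 hy'
    rw [dvd_iff_multiplicity_le (pow_ne_zero _ hf) (pow_ne_zero _ hy0)] at hdvd
    have h2 := hdvd π hπ
    rw [multiplicity_pow_of_prime hπ hf, multiplicity_pow_of_prime hπ hy0] at h2
    have h1 := congrArg (multiplicity π) hy'
    rw [multiplicity_mul_of_prime hπ hu0 hf1, multiplicity_pow_of_prime hπ hf,
        multiplicity_mul_of_prime hπ hv0 hy0] at h1
    rw [h1, mul_add]
    omega

end Divisors

namespace WittSection

theorem coeff_teichmuller_mul {p : ℕ} [Fact p.Prime] {R : Type*} [CommRing R] [CharP R p] (r : R)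
    (x : WittVector p R) (i : ℕ) :
    (WittVector.teichmuller p r * x).coeff i = r ^ p ^ i * x.coeff i := by
  induction i generalizing r x with
  | zero =>
    have : WittVector.constantCoeff (WittVector.teichmuller p r * x) =
      WittVector.constantCoeff (WittVector.teichmuller p r) * WittVector.constantCoeff x :=
      map_mul _ _ _
    simpa using this
  | succ i ih =>
    obtain ⟨x', hx, hx'⟩ := witt_eq_teichmuller_add x
    have h1 : WittVector.teichmuller p r * x = WittVector.teichmuller p (r * x.coeff 0) +
        WittVector.verschiebung (WittVector.teichmuller p (r ^ p) * x') := by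
      conv_lhs => rw [hx]
      rw [mul_add, map_mul, map_pow, ← frobenius_teichmuller, mul_comm _ x',
        WittVector.verschiebung_mul_frobenius, mul_comm (WittVector.verschiebung x')]
    rw [h1, WittVector.coeff_add_of_disjoint, WittVector.teichmuller_coeff_pos _ _ _ i.succ_pos,
      zero_add, WittVector.verschiebung_coeff_add_one, ih, hx', ← pow_mul, pow_succ']
    intro j
    cases j with
    | zero => right; simp
    | succ j => left; exact WittVector.teichmuller_coeff_pos _ _ _ j.succ_pos

/-! ### Splittings of pairs versus maps on W(A) -/

section Pair

variable {p : ℕ} [Fact p.Prime] {A : Type*} [CommRing A] [IsDomain A]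
  [UniqueFactorizationMonoid A] [CharP A p]

/-- A splitting of the pair from a splitting of `W_n(A)` which is small on the twisted ideal. -/
theorem isNQuasiFSplitPair_of_linear {n : ℕ} {f : A} (hf : f ≠ 0)
    (ψ : WittVector p A →+ A)
    (hψ : ∀ x : WittVector p A, (∀ i < n, x.coeff i = 0) → ψ x = 0)
    (hlin : ∀ a x : WittVector p A, ψ (WittVector.frobenius a * x) = a.coeff 0 * ψ x)
    (hone : ψ 1 = 1)
    (hN : ∀ y : WittVector p A, (∀ i < n, f ^ 2 ∣ y.coeff i ^ p ^ (n - 1 - i)) → f ∣ ψ y) :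
    IsNQuasiFSplitPair p n A (fun π => (1 - 2 / (p : ℚ) ^ n) * (multiplicity π f : ℚ)) := by
  classical
  have hp : p.Prime := Fact.out
  let K := FractionRing A
  have : CharP K p := charP_of_injective_algebraMap (IsFractionRing.injective A K) p
  let ι : WittVector p A →+* WittVector p K := WittVector.map (algebraMap A K)
  let T : WittVector p K := WittVector.teichmuller p (algebraMap A K f ^ p)
  -- P x y says that [f]^p x is represented by y in W_n(A); the new map is x ↦ ψ(y)/f.
  let P : WittVector p K → WittVector p A → Prop := fun x y =>
    WittVector.truncate n (T * x) = WittVector.truncate n (ι y)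
  have huniq : ∀ x y y', P x y → P x y' → ψ y = ψ y' := by
    intro x y y' h h'
    rw [← sub_eq_zero, ← map_sub]
    refine hψ _ fun i hi => ?_
    have h1 : WittVector.truncate n (ι (y - y')) = 0 := by
      rw [map_sub, map_sub, ← h, ← h', sub_self]
    have h2 := (WittVector.mem_ker_truncate n _).1 h1 i hi
    rw [WittVector.map_coeff] at h2
    exact IsFractionRing.injective A K (by rw [h2, map_zero])
  let ψ' : WittVector p K → A := fun x =>
    if h : ∃ a y, P x y ∧ ψ y = f * a then h.choose else 0
  have hψ' : ∀ x y a, P x y → ψ y = f * a → ψ' x = a := by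
    intro x y a h h'
    have hex : ∃ a y, P x y ∧ ψ y = f * a := ⟨a, y, h, h'⟩
    obtain ⟨y', h1, h2⟩ := hex.choose_spec
    have : ψ' x = hex.choose := dif_pos hex
    rw [this]
    apply mul_left_cancel₀ hf
    rw [← h2, ← h', huniq x y' y h1 h]
  have hsec : ∀ x ∈ wittDivisorSections p n (A := A)
      (fun π => (p : ℚ) * ((1 - 2 / (p : ℚ) ^ n) * (multiplicity π f : ℚ))),
      ∃ y a, P x y ∧ ψ y = f * a := by
    intro x hx
    have hx' : ∀ i, ∃ y : A, i < n → algebraMap A K y = x.coeff i * algebraMap A K f ^ p ^ (i + 1) ∧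
        f ^ 2 ∣ y ^ p ^ (n - 1 - i) := by
      intro i
      by_cases hi : i < n
      · obtain ⟨y, hy⟩ := (mem_divisorSections_iff p hp.pos hi hf _).1 (hx i hi)
        exact ⟨y, fun _ => hy⟩
      · exact ⟨0, fun h => absurd h hi⟩
    choose y hy using hx'
    obtain ⟨a, ha⟩ := hN (WittVector.mk p y) fun i hi => (hy i hi).2
    refine ⟨WittVector.mk p y, a, ?_, ha⟩
    apply TruncatedWittVector.ext
    intro i
    rw [WittVector.coeff_truncate, WittVector.coeff_truncate, coeff_teichmuller_mul,
      WittVector.map_coeff, WittVector.coeff_mk, (hy i i.2).1, ← pow_mul, ← pow_succ', mul_comm]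
  have hfrob : ∀ a : WittVector p A,
      P (ι (WittVector.frobenius a)) (WittVector.frobenius (WittVector.teichmuller p f * a)) := by
    intro a
    change WittVector.truncate n (T * _) = WittVector.truncate n (ι _)
    rw [map_mul WittVector.frobenius, map_mul ι, frobenius_teichmuller, ← map_pow (WittVector.teichmuller p)]
    congr 2
    rw [WittVector.map_teichmuller, map_pow]
  have hcz : ∀ a b : WittVector p A, (a * b).coeff 0 = a.coeff 0 * b.coeff 0 := fun a b =>
    map_mul (WittVector.constantCoeff : WittVector p A →+* A) a b
  refine ⟨ψ', ?_, ?_, ?_, ?_⟩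
  · intro x hx x' hx'
    obtain ⟨y, a, h1, h2⟩ := hsec x hx
    obtain ⟨y', a', h1', h2'⟩ := hsec x' hx'
    rw [hψ' x y a h1 h2, hψ' x' y' a' h1' h2', hψ' (x + x') (y + y') (a + a')]
    · change _ = _
      rw [mul_add, map_add, map_add, map_add, h1, h1']
    · rw [map_add, h2, h2', mul_add]
  · intro x hx
    refine hψ' x 0 0 ?_ (by simp)
    change _ = _
    rw [map_mul, map_zero, map_zero, (WittVector.mem_ker_truncate n x).2 hx, mul_zero]
  · intro b x hx
    obtain ⟨y, a, h1, h2⟩ := hsec x hx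
    rw [hψ' x y a h1 h2]
    refine hψ' _ (WittVector.frobenius b * y) _ ?_ ?_
    · change _ = _
      rw [map_mul ι, map_mul _ _ (ι y), ← h1, ← map_mul]
      congr 1
      ring
    · rw [hlin, h2]; ring
  · intro a
    refine hψ' _ _ _ (hfrob a) ?_
    rw [← mul_one (WittVector.frobenius _), hlin, hone, hcz, WittVector.teichmuller_coeff_zero,
      mul_one]

/-- A splitting of the pair restricts to a splitting of `W_n(A)` which is small on the twisted
ideal. -/
theorem exists_linear_of_isNQuasiFSplitPair {n : ℕ} {f : A} (hf : f ≠ 0)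
    (h : IsNQuasiFSplitPair p n A (fun π => (1 - 2 / (p : ℚ) ^ n) * (multiplicity π f : ℚ))) :
    ∃ ψ : WittVector p A →+ A,
      (∀ x : WittVector p A, (∀ i < n, x.coeff i = 0) → ψ x = 0) ∧
      (∀ a x : WittVector p A, ψ (WittVector.frobenius a * x) = a.coeff 0 * ψ x) ∧
      ψ 1 = 1 ∧
      ∀ y : WittVector p A, (∀ i < n, f ^ 2 ∣ y.coeff i ^ p ^ (n - 1 - i)) → f ∣ ψ y := by
  have hp : p.Prime := Fact.out
  let K := FractionRing A
  have : CharP K p := charP_of_injective_algebraMap (IsFractionRing.injective A K) p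
  let ι : WittVector p A →+* WittVector p K := WittVector.map (algebraMap A K)
  have hfK : algebraMap A K f ≠ 0 := fun h0 =>
    hf (IsFractionRing.injective A K (by rw [h0, map_zero]))
  obtain ⟨ψ, hadd, hkill, hlin, hone⟩ := h
  have hsec : ∀ y : WittVector p A, ι y ∈ wittDivisorSections p n (A := A)
      (fun π => (p : ℚ) * ((1 - 2 / (p : ℚ) ^ n) * (multiplicity π f : ℚ))) := by
    intro y i hi
    refine (mem_divisorSections_iff p hp.pos hi hf _).2 ⟨y.coeff i * f ^ p ^ (i + 1), ?_, ?_⟩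
    · rw [WittVector.map_coeff, map_mul, map_pow]
    · refine Dvd.dvd.trans ?_ (dvd_pow_self _ (pow_pos hp.pos _).ne')
      exact Dvd.dvd.mul_left (pow_dvd_pow f (two_le_pow p i)) _
  have hmapF : ∀ a : WittVector p A, ι (WittVector.frobenius a) = WittVector.frobenius (ι a) :=
    fun a => (WittVector.frobenius_isPoly p).map (algebraMap A K) a
  refine ⟨⟨⟨fun y => ψ (ι y), ?_⟩, ?_⟩, ?_, ?_, ?_, ?_⟩
  · rw [map_zero]
    exact hkill 0 (fun i _ => WittVector.zero_coeff p K i)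
  · intro x y
    change ψ (ι (x + y)) = _
    rw [map_add, hadd _ (hsec x) _ (hsec y)]
  · intro x hx
    refine hkill _ fun i hi => ?_
    rw [WittVector.map_coeff, hx i hi, map_zero]
  · intro a x
    change ψ (ι _) = _ * ψ (ι x)
    rw [map_mul]
    exact hlin a (ι x) (hsec x)
  · change ψ (ι 1) = 1
    have := hone 1
    rw [map_one] at this
    rw [this]
    exact map_one (WittVector.constantCoeff : WittVector p A →+* A)
  · intro y hy
    -- Inverse of the twist: y = F([f]) x, so linearity gives ψ(y) = f ψ(x).
    let x : WittVector p K := WittVector.teichmuller p ((algebraMap A K f)⁻¹ ^ p) * ι y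
    have hx : x ∈ wittDivisorSections p n (A := A)
        (fun π => (p : ℚ) * ((1 - 2 / (p : ℚ) ^ n) * (multiplicity π f : ℚ))) := by
      intro i hi
      refine (mem_divisorSections_iff p hp.pos hi hf _).2 ⟨y.coeff i, ?_, hy i hi⟩
      rw [coeff_teichmuller_mul, WittVector.map_coeff, ← pow_mul, ← pow_succ', mul_right_comm,
        ← mul_pow, inv_mul_cancel₀ hfK, one_pow, one_mul]
    have h1 := hlin (WittVector.teichmuller p f) x hx
    refine ⟨ψ x, ?_⟩
    rw [WittVector.teichmuller_coeff_zero] at h1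
    rw [← h1]
    change ψ _ = ψ (ι _ * _)
    congr 1
    rw [hmapF, WittVector.map_teichmuller, frobenius_teichmuller, ← map_pow, ← mul_assoc,
      ← map_mul, ← mul_pow, mul_inv_cancel₀ hfK, one_pow, map_one, one_mul]

end Pair

/-! ### Descent of splittings to the quotient -/

section Quotient

variable {p : ℕ} [Fact p.Prime] {A : Type*} [CommRing A]

/-- A splitting of `W_n(A)` compatible with an ideal descends to the quotient. -/
theorem isNQuasiFSplit_quotient {n : ℕ} {f : A} (ψ : WittVector p A →+ A)
    (hlin : ∀ a x : WittVector p A, ψ (WittVector.frobenius a * x) = a.coeff 0 * ψ x)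
    (hone : ψ 1 = 1)
    (hN : ∀ y : WittVector p A, (∀ i < n, f ∣ y.coeff i) → f ∣ ψ y) :
    IsNQuasiFSplit p n (A ⧸ Ideal.span {f}) := by
  let π : A →+* A ⧸ Ideal.span {f} := Ideal.Quotient.mk _
  let ι : WittVector p A →+* WittVector p (A ⧸ Ideal.span {f}) := WittVector.map π
  have hι : Function.Surjective ι := WittVector.map_surjective π Ideal.Quotient.mk_surjective
  have hπ : ∀ a, π a = 0 ↔ f ∣ a := fun a => by
    rw [Ideal.Quotient.eq_zero_iff_mem, Ideal.mem_span_singleton]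
  have hmapF : ∀ a : WittVector p A, ι (WittVector.frobenius a) = WittVector.frobenius (ι a) :=
    fun a => (WittVector.frobenius_isPoly p).map π a
  have h0 : ∀ y, (∀ i < n, (ι y).coeff i = 0) → π (ψ y) = 0 := by
    intro y hy
    rw [hπ]
    refine hN y fun i hi => ?_
    rw [← hπ, ← hy i hi, WittVector.map_coeff]
  have hwd : ∀ y y', ι y = ι y' → π (ψ y) = π (ψ y') := by
    intro y y' h
    rw [← sub_eq_zero, ← map_sub, ← map_sub]
    refine h0 _ fun i _ => ?_
    rw [map_sub, h, sub_self, WittVector.zero_coeff]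
  choose L hL using hι
  have hone' : ∀ a, ψ (WittVector.frobenius a) = a.coeff 0 := fun a => by
    rw [← mul_one (WittVector.frobenius a), hlin, hone, mul_one]
  have hcz : ∀ a, π ((L a).coeff 0) = a.coeff 0 := fun a => by
    conv_rhs => rw [← hL a]
    rw [WittVector.map_coeff]
  refine ⟨⟨⟨fun x => π (ψ (L x)), ?_⟩, ?_⟩, ?_, ?_, ?_⟩
  · rw [hwd (L 0) 0 (by rw [hL, map_zero]), map_zero, map_zero]
  · intro x y
    change π (ψ (L (x + y))) = π (ψ (L x)) + π (ψ (L y))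
    rw [hwd (L (x + y)) (L x + L y) (by rw [map_add, hL, hL, hL]), map_add, map_add]
  · intro x hx
    exact h0 _ (by rwa [hL])
  · intro a x
    change π (ψ (L (WittVector.frobenius a * x))) = a.coeff 0 * π (ψ (L x))
    rw [hwd (L (WittVector.frobenius a * x)) (WittVector.frobenius (L a) * L x)
      (by rw [map_mul, hmapF, hL, hL, hL]), hlin, map_mul, hcz]
  · intro a
    change π (ψ (L (WittVector.frobenius a))) = a.coeff 0
    rw [hwd (L (WittVector.frobenius a)) (WittVector.frobenius (L a))
      (by rw [hmapF, hL, hL]), hone', hcz]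

end Quotient

end WittSection

/-! ## Splitting criteria for weighted homogeneous polynomials -/

namespace WittSection

open MvPolynomial

variable {p : ℕ} [Fact p.Prime] {σ k : Type*} [Field k] [CharP k p] [IsAlgClosed k]

local notation "τ" => WittVector.teichmuller p

/-- Split y = [y_0] + V(y'): the Teichmüller term is the hypothesis at level i, and V moves y' to
level i+1 at the cost of one u. -/
theorem IsSystem.dvd_apply_of_coeff [Finite σ] {n : ℕ}
    {χ : ℕ → (WittVector p (MvPolynomial σ k) →+ MvPolynomial σ k)} {f : MvPolynomial σ k}
    (hχ : IsSystem p σ k n χ) (m : ℕ → ℕ)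
    (h : ∀ i w, i < n → f ^ p ^ (i + 1) ∣ χ i (τ f ^ m i * w)) (i : ℕ)
    (y : WittVector p (MvPolynomial σ k)) (hy : ∀ j, i + j < n → f ^ m (i + j) ∣ y.coeff j) :
    f ^ p ^ (i + 1) ∣ χ i y := by
  obtain ⟨j, hj⟩ : ∃ j, n ≤ i + j := ⟨n, by omega⟩
  induction j generalizing i y with
  | zero => rw [hχ.eq_zero i hj]; exact dvd_zero _
  | succ j ih =>
    rcases lt_or_ge i n with hi | hi
    · obtain ⟨y', hy1, hy2⟩ := witt_eq_teichmuller_add y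
      obtain ⟨c, hc⟩ := hy 0 hi
      rw [hy1, map_add, hχ.versch]
      refine dvd_add ?_ ?_
      · rw [hc, map_mul, map_pow]
        exact h i _ hi
      · apply pow_dvd_cartier
        rw [← pow_succ']
        refine ih (i + 1) y' (fun l hl => ?_) (by omega)
        rw [hy2, show i + 1 + l = i + (l + 1) by ring]
        exact hy _ (by omega)
    · rw [hχ.eq_zero i hi]; exact dvd_zero _

/-- A splitting attached to a sequence `h` with `h_i = θ(h_{i+1})`. -/
theorem exists_linear_of_theta [Finite σ] {n : ℕ} {f : MvPolynomial σ k}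
    {F D : MvPolynomial σ (WittVector p k)} (hn : 1 ≤ n) (hF : red p σ k F = f)
    (hD : F ^ p = frobLift p σ k F + p * D) {h : ℕ → MvPolynomial σ k}
    (hh : ∀ i, i + 1 < n → h i = theta (p := p) f (red p σ k D) (h (i + 1)))
    (hker : ∀ i, 1 ≤ i → i < n → cartier p (f ^ (p - 2) * h i) = 0) {c : k} (hc : c ≠ 0)
    (h0 : cartier p (f ^ (p - 2) * h 0) = C c) :
    ∃ ψ : WittVector p (MvPolynomial σ k) →+ MvPolynomial σ k,
      (∀ x, (∀ i < n, x.coeff i = 0) → ψ x = 0) ∧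
      (∀ a x, ψ (WittVector.frobenius a * x) = a.coeff 0 * ψ x) ∧ ψ 1 = 1 ∧
      (∀ y, (∀ i, i + 1 < n → f ∣ y.coeff i) → (∀ i, i + 1 = n → f ^ 2 ∣ y.coeff i) → f ∣ ψ y) ∧
      (f ∣ h (n - 1) → ∀ y, (∀ i < n, f ∣ y.coeff i) → f ∣ ψ y) := by
  have hp : p.Prime := Fact.out
  have hu : ∀ i, cartier p (f ^ (p ^ (i + 1) - 2) * h i) =
      f ^ (p ^ i - 1) * cartier p (f ^ (p - 2) * h i) := by
    intro i
    have := cartier_mul_pow_sub_two (p := p) f 1 (h i) i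
    rwa [one_mul, mul_one] at this
  obtain ⟨χ, hχ, hχ1⟩ := exists_system (p := p) n
    (fun i => if i < n then f ^ (p ^ (i + 1) - 2) * h i else 0)
    (fun i hi => by
      split_ifs with hin
      · rw [hu, hker i hi hin, mul_zero]
      · rw [map_zero])
    (fun i hi => if_neg (not_lt.2 hi))
  have hg : ∀ i < n, χ i 1 = f ^ (p ^ (i + 1) - 2) * h i := fun i hi => by rw [hχ1, if_pos hi]
  obtain ⟨hsq, hone⟩ := hχ.dvd_of_theta hF hD hg hh
  have hsmall : ∀ y, f ^ p ^ (0 + 1) ∣ χ 0 y → f ∣ C c⁻¹ * cartier p (χ 0 y) := by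
    intro y hy
    refine Dvd.dvd.mul_left ?_ _
    have := pow_dvd_cartier p (n := 1) (f := f) (g := χ 0 y) (by simpa using hy)
    simpa using this
  refine ⟨(AddMonoidHom.mulLeft (C c⁻¹)).comp ((cartier p).comp (χ 0)), ?_, ?_, ?_, ?_, ?_⟩
  · intro x hx
    change C c⁻¹ * cartier p (χ 0 x) = 0
    rw [hχ.eq_zero_of_coeff hx, map_zero, mul_zero]
  · intro a x
    change C c⁻¹ * cartier p (χ 0 _) = a.coeff 0 * (C c⁻¹ * cartier p (χ 0 x))
    rw [hχ.cartier_linear]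
    ring
  · change C c⁻¹ * cartier p (χ 0 1) = 1
    rw [hg 0 (by omega), hu, h0, pow_zero, Nat.sub_self, pow_zero, one_mul, ← C_mul,
      inv_mul_cancel₀ hc, C_1]
  · intro y hy1 hy2
    refine hsmall y (hχ.dvd_apply_of_coeff (fun i => if i + 1 < n then 1 else 2) ?_ 0 y ?_)
    · intro i w hi
      split_ifs with h
      · rw [pow_one]; exact hone i h w
      · exact hsq i w
    · intro j hj
      rw [zero_add] at hj ⊢
      split_ifs with h
      · rw [pow_one]; exact hy1 j h
      · exact hy2 j (by omega)
  · intro hlast y hy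
    refine hsmall y (hχ.dvd_apply_of_coeff (fun _ => 1) ?_ 0 y ?_)
    · intro i w hi
      rw [pow_one]
      rcases Nat.lt_or_ge (i + 1) n with h | h
      · exact hone i h w
      · have hi' : i = n - 1 := by omega
        refine (hχ.dvd_apply_mul_iff hF hD fun l hl => ?_).2 ?_ w
        · rw [hχ.eq_zero l (by omega)]; exact dvd_zero _
        · rw [hχ.eq_zero (i + 1) h, mul_zero, map_zero, add_zero, hg i hi]
          -- The extra factor f in h_{n-1} replaces the second factor otherwise needed at the top
          -- level.
          obtain ⟨e, he⟩ := hlast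
          rw [hi', he, ← hi']
          refine ⟨e, ?_⟩
          have h2 := two_le_pow p i
          calc f * (f ^ (p ^ (i + 1) - 2) * (f * e)) = f ^ (p ^ (i + 1) - 2 + 2) * e := by ring
            _ = _ := by rw [Nat.sub_add_cancel h2]
    · intro j hj
      rw [pow_one]
      exact hy j (by omega)

/-- The sequence `h` attached to a splitting of a pair. -/
theorem exists_theta_of_linear [Fintype σ] {n : ℕ} {f : MvPolynomial σ k} (hf : f ≠ 0)
    {F D : MvPolynomial σ (WittVector p k)} (hF : red p σ k F = f)
    (hD : F ^ p = frobLift p σ k F + p * D)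
    (ψ : WittVector p (MvPolynomial σ k) →+ MvPolynomial σ k)
    (hψ : ∀ x, (∀ i < n, x.coeff i = 0) → ψ x = 0)
    (hlin : ∀ a x, ψ (WittVector.frobenius a * x) = a.coeff 0 * ψ x) (hone : ψ 1 = 1)
    (hN : ∀ y, (∀ i < n, f ^ 2 ∣ y.coeff i ^ p ^ (n - 1 - i)) → f ∣ ψ y) :
    ∃ h : ℕ → MvPolynomial σ k,
      (∀ i, i + 1 < n → f ∣ h i - theta (p := p) f (red p σ k D) (h (i + 1))) ∧
      (∀ i, 1 ≤ i → cartier p (f ^ (p - 2) * h i) = 0) ∧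
      cartier p (f ^ (p - 2) * h 0) = 1 := by
  have hp : p.Prime := Fact.out
  obtain ⟨χ, hχ, hχψ⟩ := exists_system_of_linear n ψ hψ hlin
  -- Here u^{i+1}(c̄ χ_i(z)) = ψ(V^i(z sec(c))), so ψ controls the divisibility of χ_i(z) by
  -- f^{p^{i+1}}.
  have hdvd : ∀ i z, (∀ c, f ∣ ψ (WittVector.verschiebung^[i] (z * c))) →
      f ^ p ^ (i + 1) ∣ χ i z := by
    intro i z h
    refine dvd_of_dvd_cartier_iterate (i + 1) fun a => ?_
    obtain ⟨c, rfl⟩ := red_surjective (p := p) a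
    have h1 := h (sec p σ k c)
    rwa [hχψ, hχ.iterate_versch, zero_add, mul_comm z, hχ.sec_mul,
      ← Function.iterate_succ_apply' (cartier p)] at h1
  have hsmall : ∀ i (g : MvPolynomial σ k) w, (∀ j, i + j < n →
      f ^ 2 ∣ (g ^ p ^ j) ^ p ^ (n - 1 - (i + j))) →
      f ∣ ψ (WittVector.verschiebung^[i] (τ g * w)) := by
    intro i g w h
    refine hN _ fun j hj => ?_
    rcases lt_or_ge j i with hji | hji
    · rw [WittVector.iterate_verschiebung_coeff_eq_zero _ hji, zero_pow (pow_pos hp.pos _).ne']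
      exact dvd_zero _
    · obtain ⟨l, rfl⟩ := Nat.exists_eq_add_of_le hji
      rw [add_comm i l, WittVector.iterate_verschiebung_coeff, coeff_teichmuller_mul, mul_pow,
        add_comm l i]
      exact Dvd.dvd.mul_right (h l hj) _
  obtain ⟨h, hh1, hh2⟩ := hχ.exists_theta hf hF hD
    (fun i hi w => hdvd i _ fun c => by
      rw [mul_assoc]
      refine hsmall i f _ fun j hj => ?_
      rw [← pow_mul, ← pow_add]
      refine pow_dvd_pow f ?_
      -- Below the top level the exponent is p^{n-1-i} ≥ 2, so one factor [f] already lies in the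
      -- twisted ideal.
      obtain ⟨e, he⟩ : ∃ e, j + (n - 1 - (i + j)) = e + 1 := ⟨n - 1 - i - 1, by omega⟩
      rw [he]
      exact two_le_pow p e)
    (fun i hi w => hdvd i _ fun c => by
      rw [mul_assoc, ← map_pow]
      refine hsmall i _ _ fun j hj => ?_
      obtain rfl : j = 0 := by omega
      rw [← pow_mul, ← pow_mul]
      exact pow_dvd_pow f (Nat.le_mul_of_pos_right _
        (Nat.mul_pos (pow_pos hp.pos _) (pow_pos hp.pos _))))
  have hu : ∀ i, cartier p (χ i 1) = f ^ (p ^ i - 1) * cartier p (f ^ (p - 2) * h i) := by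
    intro i
    have := cartier_mul_pow_sub_two (p := p) f 1 (h i) i
    rwa [one_mul, mul_one, ← hh1] at this
  refine ⟨h, hh2, fun i hi => ?_, ?_⟩
  · have h1 := hu i
    rw [show i = i - 1 + 1 by omega, hχ.cartier_apply_one, eq_comm, mul_eq_zero,
      show i - 1 + 1 = i by omega] at h1
    exact h1.resolve_left (pow_ne_zero _ hf)
  · have h1 := hu 0
    rw [← hχψ, hone, pow_zero, Nat.sub_self, pow_zero, one_mul] at h1
    exact h1.symm

/-! ### Weighted homogeneous polynomials of Calabi–Yau degree -/

/-- The functionals `h ↦ (u(f^{p-2} θ^s(h)))(0)`. -/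
noncomputable def nu [Finite σ] (f Δ : MvPolynomial σ k) : ℕ → (MvPolynomial σ k →+ k)
  | 0 => (MvPolynomial.constantCoeff : MvPolynomial σ k →+* k).toAddMonoidHom.comp
      ((cartier p).comp (AddMonoidHom.mulLeft (f ^ (p - 2))))
  | s + 1 => (nu f Δ s).comp (theta (p := p) f Δ)

theorem nu_zero [Finite σ] (f Δ h : MvPolynomial σ k) :
    nu (p := p) f Δ 0 h = coeff 0 (cartier p (f ^ (p - 2) * h)) := rfl

theorem nu_succ [Finite σ] (f Δ h : MvPolynomial σ k) (s : ℕ) :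
    nu (p := p) f Δ (s + 1) h = nu (p := p) f Δ s (theta (p := p) f Δ h) := rfl

theorem nu_add [Finite σ] (f Δ h : MvPolynomial σ k) (s t : ℕ) :
    nu (p := p) f Δ (s + t) h = nu (p := p) f Δ s ((theta (p := p) f Δ)^[t] h) := by
  induction t generalizing h with
  | zero => rfl
  | succ t ih => rw [← add_assoc, nu_succ, ih, Function.iterate_succ_apply]

theorem nu_eq_nu_zero [Finite σ] (f Δ h : MvPolynomial σ k) (s : ℕ) :
    nu (p := p) f Δ s h = coeff 0 (cartier p (f ^ (p - 2) * (theta (p := p) f Δ)^[s] h)) := by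
  rw [← nu_zero f Δ, ← nu_add, zero_add]

theorem theta_C_mul [Finite σ] (f Δ h : MvPolynomial σ k) (c : k) :
    theta (p := p) f Δ (C c * h) =
      C ((frobeniusEquiv k p).symm c) * theta (p := p) f Δ h := by
  rw [theta_apply, theta_apply, mul_left_comm, cartier_C_mul, mul_neg]

/-- ν_s is only semilinear, but its kernel is still stable under scalars. -/
theorem nu_C_mul_eq_zero [Finite σ] {f Δ h : MvPolynomial σ k} {s : ℕ} (c : k)
    (hs : nu (p := p) f Δ s h = 0) : nu (p := p) f Δ s (C c * h) = 0 := by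
  induction s generalizing h c with
  | zero =>
    rw [nu_zero] at hs ⊢
    rw [mul_left_comm, cartier_C_mul, coeff_C_mul, hs, mul_zero]
  | succ s ih =>
    rw [nu_succ] at hs ⊢
    rw [theta_C_mul]
    exact ih _ hs

theorem eq_C_of_isWeightedHomogeneous_zero {σ k : Type*} [Field k] [Fintype σ] {q : σ → ℕ} (hq : ∀ j, 0 < q j)
    {g : MvPolynomial σ k} (hg : IsWeightedHomogeneous q g 0) : g = C (coeff 0 g) := by
  classical
  ext β
  rw [coeff_C]
  split_ifs with h
  · rw [h]
  · by_contra hne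
    have h1 := hg hne
    rw [Finsupp.weight_eq_sum, Finset.sum_eq_zero_iff] at h1
    refine h (Finsupp.ext fun j => ?_)
    have := h1 j (Finset.mem_univ j)
    rw [smul_eq_mul, Nat.mul_eq_zero] at this
    exact (this.resolve_right (hq j).ne').symm

section Graded

variable [Fintype σ] {q : σ → ℕ} {f Δ : MvPolynomial σ k}

theorem sub_two_mul_add (p : ℕ) [Fact p.Prime] (d : ℕ) : (p - 2) * d + d = (p - 1) * d := by
  have hp : 2 ≤ p := (Fact.out : p.Prime).two_le
  obtain ⟨r, rfl⟩ := Nat.exists_eq_add_of_le hp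
  rw [show 2 + r - 2 = r by omega, show 2 + r - 1 = r + 1 by omega]
  ring

/-- The Calabi–Yau degree enters here: (p-2)d + pd + d = pd + (p-1)∑ q_j precisely because d = ∑
q_j. -/
theorem isWeightedHomogeneous_theta (hf : IsWeightedHomogeneous q f (∑ j, q j))
    (hΔ : IsWeightedHomogeneous q Δ (p * ∑ j, q j)) {h : MvPolynomial σ k}
    (hh : IsWeightedHomogeneous q h (∑ j, q j)) :
    IsWeightedHomogeneous q (theta (p := p) f Δ h) (∑ j, q j) := by
  refine (IsWeightedHomogeneous.cartier p (((hf.pow (p - 2)).mul hΔ).mul hh) ?_).neg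
  rw [smul_eq_mul, ← sub_two_mul_add p]
  ring

theorem isWeightedHomogeneous_theta_iterate (hf : IsWeightedHomogeneous q f (∑ j, q j))
    (hΔ : IsWeightedHomogeneous q Δ (p * ∑ j, q j)) {h : MvPolynomial σ k}
    (hh : IsWeightedHomogeneous q h (∑ j, q j)) (s : ℕ) :
    IsWeightedHomogeneous q ((theta (p := p) f Δ)^[s] h) (∑ j, q j) := by
  induction s generalizing h with
  | zero => exact hh
  | succ s ih => exact ih (isWeightedHomogeneous_theta hf hΔ hh)

theorem cartier_eq_C_nu (hq : ∀ j, 0 < q j) (hf : IsWeightedHomogeneous q f (∑ j, q j))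
    (hΔ : IsWeightedHomogeneous q Δ (p * ∑ j, q j)) {h : MvPolynomial σ k}
    (hh : IsWeightedHomogeneous q h (∑ j, q j)) (s : ℕ) :
    cartier p (f ^ (p - 2) * (theta (p := p) f Δ)^[s] h) = C (nu (p := p) f Δ s h) := by
  rw [nu_eq_nu_zero]
  refine eq_C_of_isWeightedHomogeneous_zero hq (IsWeightedHomogeneous.cartier p
    ((hf.pow (p - 2)).mul (isWeightedHomogeneous_theta_iterate hf hΔ hh s)) ?_)
  rw [smul_eq_mul, sub_two_mul_add]
  ring

theorem theta_weightedHomogeneousComponent (hf : IsWeightedHomogeneous q f (∑ j, q j))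
    (hΔ : IsWeightedHomogeneous q Δ (p * ∑ j, q j)) (h : MvPolynomial σ k) :
    theta (p := p) f Δ (weightedHomogeneousComponent q (∑ j, q j) h) =
      weightedHomogeneousComponent q (∑ j, q j) (theta (p := p) f Δ h) := by
  rw [theta_apply, theta_apply, map_neg, weightedHomogeneousComponent_cartier,
    ← weightedHomogeneousComponent_mul_left q ((hf.pow (p - 2)).mul hΔ)]
  congr 4
  rw [smul_eq_mul, ← sub_two_mul_add p]
  ring

theorem nu_zero_weightedHomogeneousComponent (hf : IsWeightedHomogeneous q f (∑ j, q j))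
    (h : MvPolynomial σ k) :
    nu (p := p) f Δ 0 (weightedHomogeneousComponent q (∑ j, q j) h) = nu (p := p) f Δ 0 h := by
  classical
  have h1 : ∀ x : MvPolynomial σ k, coeff 0 x = coeff 0 (weightedHomogeneousComponent q 0 x) := by
    intro x
    rw [coeff_weightedHomogeneousComponent, if_pos (map_zero _)]
  rw [nu_zero, nu_zero, h1 (cartier p (f ^ (p - 2) * h)), weightedHomogeneousComponent_cartier,
    ← weightedHomogeneousComponent_mul_left q (hf.pow (p - 2))]
  congr 4
  rw [smul_eq_mul, sub_two_mul_add]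
  ring

/-- A splitting of the pair yields a form of degree `d` on which the first functionals vanish. -/
theorem exists_nu_of_isNQuasiFSplitPair (hq : ∀ j, 0 < q j) (hf0 : f ≠ 0)
    {F D : MvPolynomial σ (WittVector p k)} (hF : red p σ k F = f)
    (hD : F ^ p = frobLift p σ k F + p * D)
    (hf : IsWeightedHomogeneous q f (∑ j, q j))
    (hΔ : IsWeightedHomogeneous q (red p σ k D) (p * ∑ j, q j)) {n : ℕ} (hn : 1 ≤ n)
    (hfn : ∀ s, s + 1 < n → nu (p := p) f (red p σ k D) s f = 0)
    (hsplit : IsNQuasiFSplitPair p n (MvPolynomial σ k)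
      (fun π => (1 - 2 / (p : ℚ) ^ n) * (multiplicity π f : ℚ))) :
    ∃ h, IsWeightedHomogeneous q h (∑ j, q j) ∧
      (∀ s, s + 1 < n → nu (p := p) f (red p σ k D) s h = 0) ∧
      nu (p := p) f (red p σ k D) (n - 1) h ≠ 0 := by
  obtain ⟨ψ, h1, h2, h3, h4⟩ := exists_linear_of_isNQuasiFSplitPair hf0 hsplit
  obtain ⟨h, hθ, hker, hone⟩ := exists_theta_of_linear hf0 hF hD ψ h1 h2 h3 h4
  set Δ := red p σ k D with hΔdef
  let H : ℕ → MvPolynomial σ k := fun i => weightedHomogeneousComponent q (∑ j, q j) (h i)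
  -- The degree-d part of f·e is f times the degree-0 part of e, a scalar because all weights are
  -- positive.
  have hrec : ∀ i, i + 1 < n → ∃ c : k, H i = theta (p := p) f Δ (H (i + 1)) + C c * f := by
    intro i hi
    obtain ⟨e, he⟩ := hθ i hi
    have h5 : h i = theta (p := p) f Δ (h (i + 1)) + f * e := by rw [← he]; ring
    have h6 : weightedHomogeneousComponent q (∑ j, q j) (f * e) =
        f * weightedHomogeneousComponent q 0 e :=
      weightedHomogeneousComponent_mul_left q hf e 0
    refine ⟨coeff 0 (weightedHomogeneousComponent q 0 e), ?_⟩
    rw [← eq_C_of_isWeightedHomogeneous_zero hq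
      (weightedHomogeneousComponent_isWeightedHomogeneous 0 e), mul_comm, ← h6]
    change weightedHomogeneousComponent q (∑ j, q j) (h i) = _
    rw [h5, map_add, theta_weightedHomogeneousComponent hf hΔ]
  -- The errors c·f vanish under ν_s by `hfn`, so the recursion behaves as if exact.
  have hdiff : ∀ j s, s + j + 1 ≤ n → nu (p := p) f Δ s (H (n - 1 - j)) =
      nu (p := p) f Δ (s + j) (H (n - 1)) := by
    intro j
    induction j with
    | zero => intro s _; rfl
    | succ j ih =>
      intro s hs
      obtain ⟨c, hc⟩ := hrec (n - 1 - (j + 1)) (by omega)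
      rw [hc, map_add, nu_C_mul_eq_zero c (hfn s (by omega)), add_zero, ← nu_succ,
        show n - 1 - (j + 1) + 1 = n - 1 - j by omega, ih (s + 1) (by omega)]
      congr 2
      ring
  refine ⟨H (n - 1), weightedHomogeneousComponent_isWeightedHomogeneous _ _, fun s hs => ?_, ?_⟩
  · have h7 := hdiff s 0 (by omega)
    rw [zero_add] at h7
    rw [← h7, nu_zero_weightedHomogeneousComponent hf, nu_zero, hker _ (by omega), coeff_zero]
  · have h7 := hdiff (n - 1) 0 (by omega)
    rw [zero_add] at h7
    rw [← h7, Nat.sub_self, nu_zero_weightedHomogeneousComponent hf, nu_zero, hone]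
    simp

end Graded

end WittSection

/-! ## Existence of splittings -/

namespace WittSection

open MvPolynomial

variable {p : ℕ} [Fact p.Prime] {σ k : Type*} [Field k] [CharP k p] [IsAlgClosed k]

/-- The shape of `Δ(π² v)` modulo `p`-th powers. -/
theorem red_delta_sq_mul {F D P V : MvPolynomial σ (WittVector p k)}
    (hD : F ^ p = frobLift p σ k F + p * D) (hF : red p σ k F = red p σ k P ^ 2 * red p σ k V) :
    ∃ x y e, red p σ k D = red p σ k P ^ p * (2 * x) + red p σ k P ^ (2 * p) * y - e ^ p := by
  have hp : p.Prime := Fact.out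
  obtain ⟨E, hE⟩ := dvd_of_red_eq_zero (a := F - P ^ 2 * V)
    (by rw [map_sub, hF, map_mul, map_pow, sub_self])
  obtain ⟨DP, hDP⟩ := exists_delta P
  obtain ⟨DV, hDV⟩ := exists_delta V
  obtain ⟨r, hr⟩ := exists_add_pow_prime_eq hp (P ^ 2 * V) (p * E)
  obtain ⟨m, hm⟩ : ∃ m, p = m + 2 := ⟨p - 2, by have := hp.two_le; omega⟩
  have hFE : F = P ^ 2 * V + p * E := by rw [← hE]; ring
  have hφ : frobLift p σ k F = (frobLift p σ k P) ^ 2 * frobLift p σ k V +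
      p * frobLift p σ k E := by
    rw [hFE, map_add, map_mul, map_mul, map_pow, map_natCast]
  have hpe : ((p : MvPolynomial σ (WittVector p k)) * E) ^ p = p ^ 2 * (p ^ m * E ^ p) := by
    rw [mul_pow, ← mul_assoc, ← pow_add, add_comm 2 m, ← hm]
  have hp0 : (p : MvPolynomial σ (WittVector p k)) ≠ 0 := by
    rw [← map_natCast C, Ne, C_eq_zero]
    exact WittVector.p_nonzero p k
  -- The product rule for the p-derivation applied to P²V; the correction pE contributes -φ(E),
  -- which is a p-th power modulo p.
  have key : ∃ z, D = 2 * P ^ p * V ^ p * DP + P ^ (2 * p) * DV - frobLift p σ k E + p * z := by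
    have h1 : (P ^ 2 * V) ^ p = P ^ p * P ^ p * V ^ p := by ring
    have h2 : P ^ (2 * p) = P ^ p * P ^ p := by ring
    refine ⟨p ^ m * E ^ p + P ^ 2 * V * E * r - DP ^ 2 * V ^ p - 2 * P ^ p * DP * DV +
      p * DP ^ 2 * DV, mul_left_cancel₀ hp0 ?_⟩
    rw [hφ] at hD
    rw [← hFE, hpe, h1] at hr
    rw [h2]
    have h3 : frobLift p σ k P = P ^ p - p * DP := by rw [hDP]; ring
    have h4 : frobLift p σ k V = V ^ p - p * DV := by rw [hDV]; ring
    rw [h3, h4] at hD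
    linear_combination hr - hD
  obtain ⟨z, hz⟩ := key
  refine ⟨red p σ k V ^ p * red p σ k DP, red p σ k DV, red p σ k E, ?_⟩
  have h5 := congrArg (red p σ k) hz
  simp only [map_add, map_sub, map_mul, map_pow, red_frobLift, map_ofNat] at h5
  rw [h5, red_p]
  ring

section Graded

variable [Fintype σ] {q : σ → ℕ} {f : MvPolynomial σ k}
  {F D : MvPolynomial σ (WittVector p k)} {n : ℕ} {H : MvPolynomial σ k}

/-- If π² ∣ f, two applications of θ ending at θ^{n-1}(H) accumulate enough factors π to make π
divide the nonzero constant ν_{n-1}(H). The bound n ≥ 3 provides these two steps. -/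
theorem not_sq_dvd (hq : ∀ j, 0 < q j) (hF : red p σ k F = f)
    (hD : F ^ p = frobLift p σ k F + p * D) (hf : IsWeightedHomogeneous q f (∑ j, q j))
    (hΔ : IsWeightedHomogeneous q (red p σ k D) (p * ∑ j, q j))
    (hH : IsWeightedHomogeneous q H (∑ j, q j))
    (hν : ∀ s, s + 1 < n → nu (p := p) f (red p σ k D) s H = 0)
    (hν' : nu (p := p) f (red p σ k D) (n - 1) H ≠ 0) (hn : 3 ≤ n) {π : MvPolynomial σ k}
    (hπ : Prime π) : ¬ π ^ 2 ∣ f := by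
  have hp : p.Prime := Fact.out
  have hp2 := hp.two_le
  rintro ⟨v, hv⟩
  obtain ⟨P, rfl⟩ := red_surjective (p := p) π
  obtain ⟨V, rfl⟩ := red_surjective (p := p) v
  obtain ⟨x, y, e, hxy⟩ := red_delta_sq_mul hD (hF.trans hv)
  generalize red p σ k P = π at *
  have hfp : ∀ m, π ^ (2 * m) ∣ f ^ m := fun m => by
    rw [hv, mul_pow, ← pow_mul]; exact Dvd.intro _ rfl
  obtain ⟨G, hG⟩ : ∃ G : ℕ → MvPolynomial σ k,
    ∀ s, G s = (theta (p := p) f (red p σ k D))^[s] H := ⟨_, fun _ => rfl⟩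
  have hGν : ∀ s, cartier p (f ^ (p - 2) * G s) = C (nu (p := p) f (red p σ k D) s H) :=
    fun s => by rw [hG, cartier_eq_C_nu hq hf hΔ hH]
  have hθ : ∀ s, s + 1 < n → G (s + 1) =
      -cartier p (f ^ (p - 2) * (π ^ p * (2 * x) + π ^ (2 * p) * y) * G s) := by
    intro s hs
    have h1 := hGν s
    rw [hν s hs, C_0] at h1
    -- The summand e^p contributes e·u(f^{p-2}G_s) = e·ν_s(H) = 0.
    have h2 : f ^ (p - 2) * (π ^ p * (2 * x) + π ^ (2 * p) * y - e ^ p) * G s =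
        f ^ (p - 2) * (π ^ p * (2 * x) + π ^ (2 * p) * y) * G s - e ^ p * (f ^ (p - 2) * G s) := by
      ring
    rw [hG (s + 1), Function.iterate_succ_apply', ← hG, theta_apply, hxy, h2, map_sub,
      cartier_pow_mul, h1, mul_zero, sub_zero]
  have hνG := hGν (n - 1)
  obtain ⟨s, rfl⟩ : ∃ s, n = s + 3 := ⟨n - 3, by omega⟩
  have t1 := hθ s (by omega)
  have t2 := hθ (s + 1) (by omega)
  rw [show s + 3 - 1 = s + 1 + 1 by omega] at hνG hν'
  generalize G (s + 1 + 1) = G2 at *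
  generalize G (s + 1) = G1 at *
  generalize G s = G0 at *
  have e1 : π ∣ G1 := by
    rw [t1, dvd_neg, ← pow_one π]
    refine pow_dvd_cartier p (Dvd.dvd.mul_right (Dvd.dvd.mul_left ?_ _) _)
    rw [pow_one, mul_one]
    exact dvd_add (Dvd.intro _ rfl) (Dvd.dvd.mul_right (pow_dvd_pow _ (by omega)) _)
  have e2 : π ^ 2 ∣ G2 := by
    rw [t2, dvd_neg]
    refine pow_dvd_cartier p ?_
    rw [mul_add, add_mul]
    refine dvd_add ?_ (Dvd.dvd.mul_right (Dvd.dvd.mul_left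
      (Dvd.dvd.mul_right (pow_dvd_pow _ (by omega)) _) _) _)
    -- For odd p the count is 2(p-2) + p + 1 ≥ 2p; for p = 2 it fails, but the factor 2 kills the
    -- term.
    rcases hp.eq_two_or_odd with h2 | h2
    · have h3 : (2 : MvPolynomial σ k) = 0 := by
        have : ((p : ℕ) : MvPolynomial σ k) = 0 := CharP.cast_eq_zero _ _
        rw [h2] at this
        exact_mod_cast this
      rw [h3, zero_mul, mul_zero, mul_zero, zero_mul]
      exact dvd_zero _
    · have h4 : π ^ (2 * (p - 2)) * π ^ p * π ∣ f ^ (p - 2) * (π ^ p * (2 * x)) * G1 :=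
        mul_dvd_mul (mul_dvd_mul (hfp _) (Dvd.intro _ rfl)) e1
      refine Dvd.dvd.trans ?_ h4
      rw [← pow_add, ← pow_succ]
      exact pow_dvd_pow _ (by omega)
  have e3 : π ^ 1 ∣ cartier p (f ^ (p - 2) * G2) := by
    refine pow_dvd_cartier p ?_
    refine Dvd.dvd.trans ?_ (mul_dvd_mul (hfp _) e2)
    rw [← pow_add]
    exact pow_dvd_pow _ (by omega)
  rw [pow_one, hνG] at e3
  exact hπ.not_isUnit (isUnit_of_dvd_unit e3 ((isUnit_iff_ne_zero.2 hν').map C))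

theorem not_pow_dvd (hq : ∀ j, 0 < q j) (hf : IsWeightedHomogeneous q f (∑ j, q j))
    (hΔ : IsWeightedHomogeneous q (red p σ k D) (p * ∑ j, q j))
    (hH : IsWeightedHomogeneous q H (∑ j, q j)) {s : ℕ}
    (hν' : nu (p := p) f (red p σ k D) s H ≠ 0) {π : MvPolynomial σ k}
    (hπ : Prime π) : ¬ π ^ p ∣ f ^ (p - 2) := by
  intro h
  have e3 : π ^ 1 ∣ cartier p (f ^ (p - 2) * (theta (p := p) f (red p σ k D))^[s] H) := by
    refine pow_dvd_cartier p ?_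
    rw [mul_one]
    exact Dvd.dvd.mul_right h _
  rw [pow_one, cartier_eq_C_nu hq hf hΔ hH] at e3
  exact hπ.not_isUnit (isUnit_of_dvd_unit e3 ((isUnit_iff_ne_zero.2 hν').map C))

/-- If j ≥ 2 then n ≥ 3 and f is squarefree. If j = 1, a prime of multiplicity e in f has (p-2)e <
p, so 2e ≤ p·m forces e ≤ m. -/
theorem dvd_of_sq_dvd_pow (hq : ∀ j, 0 < q j) (hf0 : f ≠ 0) (hF : red p σ k F = f)
    (hD : F ^ p = frobLift p σ k F + p * D) (hf : IsWeightedHomogeneous q f (∑ j, q j))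
    (hΔ : IsWeightedHomogeneous q (red p σ k D) (p * ∑ j, q j))
    (hH : IsWeightedHomogeneous q H (∑ j, q j))
    (hν : ∀ s, s + 1 < n → nu (p := p) f (red p σ k D) s H = 0)
    (hν' : nu (p := p) f (red p σ k D) (n - 1) H ≠ 0) {j : ℕ} (hj : 1 ≤ j) (hjn : j + 1 ≤ n)
    {a : MvPolynomial σ k} (ha : f ^ 2 ∣ a ^ p ^ j) : f ∣ a := by
  have hp : p.Prime := Fact.out
  have hp2 := hp.two_le
  rcases eq_or_ne a 0 with rfl | ha0
  · exact dvd_zero _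
  rw [dvd_iff_multiplicity_le hf0 ha0]
  rw [dvd_iff_multiplicity_le (pow_ne_zero _ hf0) (pow_ne_zero _ ha0)] at ha
  intro π hπ
  have h1 := ha π hπ
  rw [multiplicity_pow_of_prime hπ hf0, multiplicity_pow_of_prime hπ ha0] at h1
  have hfin : ∀ {g : MvPolynomial σ k}, g ≠ 0 → ∀ {e}, π ^ e ∣ g ↔ e ≤ multiplicity π g :=
    fun {g} hg {e} => (FiniteMultiplicity.of_prime_left hπ hg).pow_dvd_iff_le_multiplicity
  rcases Nat.lt_or_ge 1 j with hj2 | hj2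
  · have h2 := not_sq_dvd hq hF hD hf hΔ hH hν hν' (by omega) hπ
    rw [hfin hf0] at h2
    by_contra h3
    have h4 : multiplicity π a = 0 := by omega
    rw [h4, mul_zero] at h1
    omega
  · obtain rfl : j = 1 := by omega
    have h2 := not_pow_dvd hq hf hΔ hH hν' hπ
    rw [hfin (pow_ne_zero _ hf0), multiplicity_pow_of_prime hπ hf0, Nat.sub_mul] at h2
    by_contra h3
    have h4 := Nat.mul_le_mul_left p (Nat.succ_le_of_lt (not_le.1 h3))
    rw [Nat.succ_eq_add_one, mul_add, mul_one] at h4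
    rw [pow_one] at h1
    omega

/-- A form of degree `d` on which the first functionals vanish yields a splitting of the pair. -/
theorem isNQuasiFSplitPair_of_nu (hq : ∀ j, 0 < q j) (hf0 : f ≠ 0) (hF : red p σ k F = f)
    (hD : F ^ p = frobLift p σ k F + p * D) (hf : IsWeightedHomogeneous q f (∑ j, q j))
    (hΔ : IsWeightedHomogeneous q (red p σ k D) (p * ∑ j, q j)) (hn : 1 ≤ n)
    (hH : IsWeightedHomogeneous q H (∑ j, q j))
    (hν : ∀ s, s + 1 < n → nu (p := p) f (red p σ k D) s H = 0)
    (hν' : nu (p := p) f (red p σ k D) (n - 1) H ≠ 0) :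
    IsNQuasiFSplitPair p n (MvPolynomial σ k)
      (fun π => (1 - 2 / (p : ℚ) ^ n) * (multiplicity π f : ℚ)) := by
  obtain ⟨ψ, h1, h2, h3, h4, -⟩ := exists_linear_of_theta hn hF hD
    (h := fun i => (theta (p := p) f (red p σ k D))^[n - 1 - i] H)
    (fun i hi => by
      rw [← Function.iterate_succ_apply' (theta (p := p) f (red p σ k D))]
      congr 2
      omega)
    (fun i h1 h2 => by rw [cartier_eq_C_nu hq hf hΔ hH, hν _ (by omega), C_0]) hν'
    (cartier_eq_C_nu hq hf hΔ hH (n - 1 - 0))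
  refine isNQuasiFSplitPair_of_linear hf0 ψ h1 h2 h3 fun y hy => h4 y (fun i hi => ?_)
    (fun i hi => ?_)
  · exact dvd_of_sq_dvd_pow hq hf0 hF hD hf hΔ hH hν hν' (by omega) (by omega) (hy i (by omega))
  · have := hy i (by omega)
    rwa [show n - 1 - i = 0 by omega, pow_zero, pow_one] at this

/-- If the hypersurface is not `r`-quasi-`F`-split for `r < n`, the first functionals vanish
on `f`. -/
theorem nu_self_eq_zero (hq : ∀ j, 0 < q j) (hF : red p σ k F = f)
    (hD : F ^ p = frobLift p σ k F + p * D) (hf : IsWeightedHomogeneous q f (∑ j, q j))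
    (hΔ : IsWeightedHomogeneous q (red p σ k D) (p * ∑ j, q j))
    (hns : ∀ r, 1 ≤ r → r < n → ¬ IsNQuasiFSplit p r (MvPolynomial σ k ⧸ Ideal.span {f})) (s : ℕ)
    (hs : s + 1 < n) : nu (p := p) f (red p σ k D) s f = 0 := by
  induction s using Nat.strong_induction_on with
  | _ s ih =>
    by_contra hne
    -- At the first s with ν_s(f) ≠ 0, the sequence θ^{s-i}(f) ends in f itself, so the map descends
    -- to A/f.
    obtain ⟨ψ, h1, h2, h3, -, h5⟩ := exists_linear_of_theta (n := s + 1) (by omega) hF hD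
      (h := fun i => (theta (p := p) f (red p σ k D))^[s - i] f)
      (fun i hi => by
        rw [← Function.iterate_succ_apply' (theta (p := p) f (red p σ k D))]
        congr 2
        omega)
      (fun i h1 h2 => by
        rw [cartier_eq_C_nu hq hf hΔ hf, ih _ (by omega) (by omega), C_0]) hne
      (cartier_eq_C_nu hq hf hΔ hf (s - 0))
    refine hns (s + 1) (by omega) hs (isNQuasiFSplit_quotient ψ h2 h3 (h5 ?_))
    rw [show s - (s + 1 - 1) = 0 by omega]
    exact dvd_rfl

end Graded

end WittSection

/-! ## The matrices of a family of weighted Calabi–Yau polynomials -/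

namespace WittSection

open MvPolynomial

variable {p : ℕ} [Fact p.Prime] {k : Type*} [Field k] [CharP k p] [IsAlgClosed k]

theorem frobLift_monomial {σ : Type*} (e : σ →₀ ℕ) (c : WittVector p k) :
    frobLift p σ k (monomial e c) = monomial (p • e) (WittVector.frobenius c) := by
  rw [frobLift, coe_eval₂Hom, eval₂_monomial, RingHom.comp_apply, monomial_eq,
    Finsupp.prod_of_support_subset (p • e) (Finsupp.support_smul) _ (fun _ _ => pow_zero _)]
  congr 1
  refine Finset.prod_congr rfl fun j _ => ?_
  change (X j ^ p) ^ e j = X j ^ (p • e) j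
  rw [← pow_mul, Finsupp.smul_apply, smul_eq_mul]

/-! ### The functionals as coefficients of powers of f and Δ -/

section Functional

variable {σ : Type*} [Fintype σ]

/-- The exponent of `(∏ x_j)^{p^{s+1} - 1}`. -/
noncomputable def topExponent (p : ℕ) (σ : Type*) [Finite σ] (s : ℕ) : σ →₀ ℕ :=
  Finsupp.equivFunOnFinite.symm fun _ => p ^ (s + 1) - 1

theorem cartierExponent_zero : cartierExponent p (0 : σ →₀ ℕ) = topExponent p σ 0 := by
  ext j
  change p * 0 + (p - 1) = p ^ (0 + 1) - 1
  rw [mul_zero, zero_add, zero_add, pow_one]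

theorem cartierExponent_topExponent (s : ℕ) :
    cartierExponent p (topExponent p σ s) = topExponent p σ (s + 1) := by
  ext j
  change p * (p ^ (s + 1) - 1) + (p - 1) = p ^ (s + 1 + 1) - 1
  have h1 : 1 ≤ p ^ (s + 1) := Nat.one_le_pow _ _ (Fact.out : p.Prime).pos
  have h2 := Nat.mul_le_mul_left p h1
  have h3 := (Fact.out : p.Prime).pos
  rw [Nat.mul_sub, ← pow_succ', mul_one] at *
  omega

theorem sum_pow_add_two_le (s : ℕ) : (∑ j ∈ Finset.Ico 1 (s + 1), p ^ j) + 2 ≤ p ^ (s + 1) := by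
  have hp := (Fact.out : p.Prime).two_le
  induction s with
  | zero => simpa using hp
  | succ s ih =>
    rw [Finset.sum_Ico_succ_top (by omega)]
    have : p ^ (s + 1) * 2 ≤ p ^ (s + 1 + 1) := by
      rw [pow_succ p (s + 1)]; exact Nat.mul_le_mul_left _ hp
    omega

theorem pow_sub_sum_succ (s : ℕ) :
    p ^ (s + 2) - ((∑ j ∈ Finset.Ico 1 (s + 2), p ^ j) + 2) =
      p * (p ^ (s + 1) - ((∑ j ∈ Finset.Ico 1 (s + 1), p ^ j) + 2)) + (p - 2) := by
  have h1 := sum_pow_add_two_le (p := p) s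
  have h2 := sum_pow_add_two_le (p := p) (s + 1)
  have hp := (Fact.out : p.Prime).two_le
  have h3 : ∑ j ∈ Finset.Ico 1 (s + 2), p ^ j = p + p * ∑ j ∈ Finset.Ico 1 (s + 1), p ^ j := by
    rw [Finset.sum_eq_sum_Ico_succ_bot (by omega), pow_one, Finset.mul_sum,
      ← Finset.sum_Ico_add' _ 1 (s + 1) 1]
    congr 1
    exact Finset.sum_congr rfl fun j _ => pow_succ' p j
  have h4 := Nat.mul_le_mul_left p h1
  rw [show s + 1 + 1 = s + 2 by ring] at h2
  rw [h3] at h2 ⊢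
  rw [Nat.mul_sub, ← pow_succ', mul_add] at *
  rw [show s + 1 + 1 = s + 2 by ring] at *
  omega

/-- Moving factors inside u raises them to p-th powers, so the nested operators merge and the
exponents follow a ↦ pa + (p-2) and c ↦ pc + 1. Signs and p-th roots are lost, so only vanishing is
compared. -/
theorem nu_eq_zero_iff (f Δ : MvPolynomial σ k) (s : ℕ) (h : MvPolynomial σ k) :
    nu (p := p) f Δ s h = 0 ↔ coeff (topExponent p σ s)
      (f ^ (p ^ (s + 1) - ((∑ j ∈ Finset.Ico 1 (s + 1), p ^ j) + 2)) *
        Δ ^ (∑ j ∈ Finset.range s, p ^ j) * h) = 0 := by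
  induction s generalizing h with
  | zero =>
    rw [nu_zero, coeff_cartier, EmbeddingLike.map_eq_zero_iff, cartierExponent_zero]
    simp
  | succ s ih =>
    rw [nu_succ, ih, theta_apply, mul_neg, coeff_neg, neg_eq_zero, ← cartier_pow_mul,
      coeff_cartier, EmbeddingLike.map_eq_zero_iff, cartierExponent_topExponent,
      pow_sub_sum_succ, Finset.sum_range_succ']
    have h1 : ∑ j ∈ Finset.range s, p ^ (j + 1) = (∑ j ∈ Finset.range s, p ^ j) * p := by
      rw [Finset.sum_mul]
      exact Finset.sum_congr rfl fun j _ => pow_succ p j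
    rw [h1]
    apply iff_of_eq
    congr 2
    generalize p ^ (s + 1) - ((∑ j ∈ Finset.Ico 1 (s + 1), p ^ j) + 2) = a
    generalize ∑ j ∈ Finset.range s, p ^ j = c
    rw [mul_pow, ← pow_mul, ← pow_mul, pow_add, pow_add, pow_zero, pow_one, mul_comm p a]
    ring

end Functional

/-! ### Specialisation of the universal family -/

section Family

open CYFamily

variable {N m : ℕ} {q : Fin (N + 1) → ℕ} (α : Fin m ≃ Exponents q)

theorem weight_exponent (i : Fin m) : Finsupp.weight q (α i).1 = ∑ j, q j := by
  rw [Finsupp.weight_eq_sum]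
  refine Eq.trans (Finset.sum_congr rfl fun j _ => ?_) (α i).2
  rw [smul_eq_mul, mul_comm]

theorem coeff_Gval (b : Fin m → k) (i : Fin m) : coeff (α i).1 (Gval α b) = b i := by
  classical
  rw [Gval, coeff_sum, Finset.sum_eq_single i, coeff_monomial, if_pos rfl]
  · intro j _ hj
    rw [coeff_monomial, if_neg fun h => hj (α.injective (Subtype.ext h))]
  · intro h
    exact absurd (Finset.mem_univ i) h

theorem isWeightedHomogeneous_sum_monomial {R : Type*} [CommRing R] (b : Fin m → R) :
    IsWeightedHomogeneous q (∑ i, monomial (α i).1 (b i)) (∑ j, q j) :=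
  IsWeightedHomogeneous.sum _ _ _ fun i _ =>
    isWeightedHomogeneous_monomial _ _ _ (weight_exponent α i)

theorem eq_Gval {h : MvPolynomial (Fin (N + 1)) k} (hh : IsWeightedHomogeneous q h (∑ j, q j)) :
    h = Gval α fun i => coeff (α i).1 h := by
  ext β
  by_cases hβ : Finsupp.weight q β = ∑ j, q j
  · have h1 : ∑ j, q j * β j = ∑ j, q j := by
      rw [← hβ, Finsupp.weight_eq_sum]
      exact Finset.sum_congr rfl fun j _ => by rw [smul_eq_mul, mul_comm]
    have h2 : (α (α.symm ⟨β, h1⟩)).1 = β := by rw [Equiv.apply_symm_apply]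
    conv_rhs => rw [← h2]
    rw [coeff_Gval, h2]
  · rw [hh.coeff_eq_zero _ hβ]
    exact ((isWeightedHomogeneous_sum_monomial α fun i => coeff (α i).1 h).coeff_eq_zero _ hβ).symm

/-- The lift of `G(b)` with Teichmüller coefficients. -/
noncomputable def Glift (p : ℕ) [Fact p.Prime] (b : Fin m → k) :
    MvPolynomial (Fin (N + 1)) (WittVector p k) :=
  ∑ i, monomial (α i).1 (WittVector.teichmuller p (b i))

/-- The specialization `s = [b]`, `t = 0` of the parameters. -/
noncomputable def evalParams (p : ℕ) [Fact p.Prime] (b : Fin m → k) :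
    Params m (WittVector p k) →+* WittVector p k :=
  eval (Sum.elim (fun i => WittVector.teichmuller p (b i)) 0)

/-- The specialization of `(G̃^p - φ(G̃)) / p`. -/
noncomputable def deltaLift (p : ℕ) [Fact p.Prime] [CharP k p] (b : Fin m → k) :
    MvPolynomial (Fin (N + 1)) (WittVector p k) :=
  MvPolynomial.map (evalParams p b) (dvd_pow_sub_phi p N m (Gtilde p k α)).choose

variable (b : Fin m → k)

theorem red_Glift : red p _ k (Glift α p b) = Gval α b := by
  rw [Glift, Gval, map_sum]
  refine Finset.sum_congr rfl fun i _ => ?_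
  rw [red, map_monomial, WittVector.constantCoeff_apply, WittVector.teichmuller_coeff_zero]

/-- Frobenius raises Teichmüller elements to the p-th power and fixes 0, so setting s = [b], t = 0
respects the Frobenius lifts. -/
theorem map_phi (g : Univ N m (WittVector p k)) :
    MvPolynomial.map (evalParams p b) (phi p N m k g) =
      frobLift p _ k (MvPolynomial.map (evalParams p b) g) := by
  have h1 : ∀ r, evalParams p b (phiParams p m k r) = WittVector.frobenius (evalParams p b r) := by
    intro r
    have h : (evalParams p b).comp (phiParams p m k) =
        WittVector.frobenius.comp (evalParams p b) := by
      refine MvPolynomial.ringHom_ext (fun w => ?_) (fun v => ?_)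
      · simp [evalParams, phiParams]
      · cases v with
        | inl i => simp [evalParams, phiParams, frobenius_teichmuller]
        | inr i => simp [evalParams, phiParams, (Fact.out : p.Prime).ne_zero]
    exact RingHom.congr_fun h r
  have h : (MvPolynomial.map (evalParams p b)).comp (phi p N m k) =
      (frobLift p _ k).comp (MvPolynomial.map (evalParams p b)) := by
    refine MvPolynomial.ringHom_ext (fun r => ?_) (fun j => ?_)
    · simp [phi, frobLift, h1]
    · simp [phi, frobLift]
  exact RingHom.congr_fun h g

theorem Glift_pow : Glift α p b ^ p = frobLift p _ k (Glift α p b) + p * deltaLift α p b := by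
  have h1 : MvPolynomial.map (evalParams p b) (Gtilde p k α) = Glift α p b := by
    rw [Gtilde, Glift, map_sum]
    refine Finset.sum_congr rfl fun i _ => ?_
    rw [map_monomial]
    simp [evalParams]
  have h2 := congrArg (MvPolynomial.map (evalParams p b))
    (dvd_pow_sub_phi p N m (Gtilde p k α)).choose_spec
  rw [map_sub, map_pow, map_phi, h1, map_mul, map_natCast] at h2
  rw [deltaLift, ← h2]
  ring

theorem map_DeltaG : MvPolynomial.map (eval (Sum.elim b 0)) (DeltaG p k α) =
    red p _ k (deltaLift α p b) := by
  rw [DeltaG, deltaLift, reduction, red, MvPolynomial.map_map, MvPolynomial.map_map]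
  congr 2
  refine MvPolynomial.ringHom_ext (fun w => ?_) (fun v => ?_)
  · simp [evalParams]
  · cases v with
    | inl i => simp [evalParams]
    | inr i => simp [evalParams]

/-- Homogeneity is clear for p times the quotient, and W(k) has no p-torsion. -/
theorem isWeightedHomogeneous_red_deltaLift :
    IsWeightedHomogeneous q (red p _ k (deltaLift α p b)) (p * ∑ j, q j) := by
  have h1 : IsWeightedHomogeneous q
      ((p : MvPolynomial (Fin (N + 1)) (WittVector p k)) * deltaLift α p b) (p * ∑ j, q j) := by
    have h2 : (p : MvPolynomial (Fin (N + 1)) (WittVector p k)) * deltaLift α p b =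
        Glift α p b ^ p - frobLift p _ k (Glift α p b) := by rw [Glift_pow]; ring
    rw [h2]
    refine ((isWeightedHomogeneous_sum_monomial α _).pow p).sub ?_
    rw [Glift, map_sum]
    refine IsWeightedHomogeneous.sum _ _ _ fun i _ => ?_
    rw [frobLift_monomial]
    refine isWeightedHomogeneous_monomial _ _ _ ?_
    rw [map_nsmul, weight_exponent, smul_eq_mul]
  intro β hβ
  refine h1 fun h => hβ ?_
  rw [← map_natCast C, coeff_C_mul, mul_eq_zero] at h
  rw [red, coeff_map, h.resolve_left (WittVector.p_nonzero p k), map_zero]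

theorem GMatrix_mulVec_eq_zero_iff (n : ℕ) (c : Fin m → k) (r : Fin n) :
    (GMatrix p α n b 0).mulVec c r = 0 ↔
      nu (p := p) (Gval α b) (red p _ k (deltaLift α p b)) r (Gval α c) = 0 := by
  classical
  have hG : MvPolynomial.map (eval (Sum.elim b 0)) (G k α) = Gval α b := by
    rw [G, Gval, map_sum]
    refine Finset.sum_congr rfl fun i _ => ?_
    rw [map_monomial, eval_X, Sum.elim_inl]
  rw [nu_eq_zero_iff]
  have hX : ∀ e e', Gval α b ^ e * red p _ k (deltaLift α p b) ^ e' =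
      MvPolynomial.map (eval (Sum.elim b 0)) (G k α ^ e * DeltaG p k α ^ e') := by
    intro e e'
    rw [map_mul, map_pow, map_pow, hG, map_DeltaG]
  rw [hX]
  apply iff_of_eq
  congr 1
  rw [Gval, Finset.mul_sum, coeff_sum, Matrix.mulVec, dotProduct]
  refine Finset.sum_congr rfl fun i _ => ?_
  rw [coeff_mul_monomial', GMatrix, Matrix.of_apply, Gcoeff]
  have hle : (∀ j, (α i).1 j ≤ p ^ ((r : ℕ) + 1) - 1) ↔ (α i).1 ≤ topExponent p _ r :=
    ⟨fun h => Finsupp.le_def.2 h, fun h => Finsupp.le_def.1 h⟩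
  by_cases h : (α i).1 ≤ topExponent p _ r
  · have he : (Finsupp.equivFunOnFinite.symm fun j => p ^ ((r : ℕ) + 1) - 1 - (α i).1 j) =
        topExponent p _ r - (α i).1 := by
      ext j
      rfl
    rw [if_pos h, if_pos (hle.2 h), coeff_map, he, Gn, Nat.add_sub_cancel]
  · rw [if_neg h, if_neg (fun h' => h (hle.1 h')), map_zero, zero_mul]

end Family

end WittSection

/-! ### Rank criteria -/

namespace Matrix

theorem exists_mulVec_of_rank_eq {k : Type*} [Field k] {n m : ℕ} {M : Matrix (Fin n) (Fin m) k}
    (h : M.rank = n) (v : Fin n → k) : ∃ c, M.mulVec c = v := by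
  have h1 : LinearMap.range M.mulVecLin = ⊤ := by
    apply Submodule.eq_top_of_finrank_eq
    rw [Module.finrank_fin_fun]
    exact h
  exact LinearMap.range_eq_top.1 h1 v

/-- Given a nontrivial relation among the rows, pair it with the test vector of the last row that
occurs: a single nonzero term survives. -/
theorem rank_eq_of_forall_exists {k : Type*} [Field k] {n m : ℕ} {M : Matrix (Fin n) (Fin m) k}
    (h : ∀ r, ∃ c, (∀ s < r, M.mulVec c s = 0) ∧ M.mulVec c r ≠ 0) : M.rank = n := by
  have hli : LinearIndependent k M.row := by
    rw [Fintype.linearIndependent_iff]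
    intro g hg
    classical
    by_contra! hne
    obtain ⟨r₀, hr₀⟩ := hne
    obtain ⟨r, hr, hmax⟩ := (Finset.univ.filter fun r => g r ≠ 0).exists_max_image id
      ⟨r₀, by simpa using hr₀⟩
    obtain ⟨c, hc1, hc2⟩ := h r
    have h1 : ∑ s, g s * M.mulVec c s = 0 := by
      have h2 := congrArg (fun v => v ⬝ᵥ c) hg
      simp only [sum_dotProduct, smul_dotProduct, zero_dotProduct] at h2
      exact h2
    rw [Finset.sum_eq_single r] at h1
    · exact (mul_ne_zero (by simpa using hr) hc2) h1
    · intro s _ hs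
      rcases lt_or_gt_of_ne hs with hlt | hgt
      · rw [hc1 s hlt, mul_zero]
      · have : g s = 0 := by
          by_contra hgs
          exact absurd (hmax s (by simpa using hgs)) (not_le.2 hgt)
        rw [this, zero_mul]
    · intro h3
      exact absurd (Finset.mem_univ r) h3
  rw [hli.rank_matrix, Fintype.card_fin]

end Matrix

/-! ### From ranks to splittings of pairs and back -/

open CYFamily WittSection MvPolynomial in
theorem isNQuasiFSplitPair_of_rank_eq (p : ℕ) [Fact p.Prime] {k : Type*} [Field k] [CharP k p]
    [IsAlgClosed k] {N m : ℕ} {q : Fin (N + 1) → ℕ} (hq : ∀ j, 0 < q j)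
    (α : Fin m ≃ Exponents q) {b : Fin m → k} (hf : Gval α b ≠ 0) {n : ℕ} (hn : 1 ≤ n)
    (h : (GMatrix p α n b 0).rank = n) :
    IsNQuasiFSplitPair p n (MvPolynomial (Fin (N + 1)) k)
      (fun π => (1 - 2 / (p : ℚ) ^ n) * (multiplicity π (Gval α b) : ℚ)) := by
  -- Full row rank makes every vector of row values attainable; choose zeros except in the last row.
  obtain ⟨c, hc⟩ := Matrix.exists_mulVec_of_rank_eq h (Pi.single ⟨n - 1, by omega⟩ 1)
  refine isNQuasiFSplitPair_of_nu hq hf (red_Glift α b) (Glift_pow α b)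
    (isWeightedHomogeneous_sum_monomial α b) (isWeightedHomogeneous_red_deltaLift α b) hn
    (isWeightedHomogeneous_sum_monomial α c) (fun s hs => ?_) ?_
  · refine (GMatrix_mulVec_eq_zero_iff α b n c ⟨s, by omega⟩).1 ?_
    rw [hc, Pi.single_eq_of_ne]
    intro h
    have := congrArg Fin.val h
    simp only at this
    omega
  · refine fun h0 => ?_
    have := (GMatrix_mulVec_eq_zero_iff α b n c ⟨n - 1, by omega⟩).2 h0
    rw [hc, Pi.single_eq_same] at this
    exact one_ne_zero this

open CYFamily WittSection MvPolynomial in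
theorem rank_eq_of_isNQuasiFSplitPair (p : ℕ) [Fact p.Prime] {k : Type*} [Field k] [CharP k p]
    [IsAlgClosed k] {N m : ℕ} {q : Fin (N + 1) → ℕ} (hq : ∀ j, 0 < q j)
    (α : Fin m ≃ Exponents q) {b : Fin m → k} (hf : Gval α b ≠ 0) {n : ℕ}
    (hns : ∀ r, 1 ≤ r → r < n →
      ¬ IsNQuasiFSplit p r (MvPolynomial (Fin (N + 1)) k ⧸ Ideal.span {Gval α b}))
    (hpair : ∀ r, 1 ≤ r → r ≤ n → IsNQuasiFSplitPair p r (MvPolynomial (Fin (N + 1)) k)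
      (fun π => (1 - 2 / (p : ℚ) ^ r) * (multiplicity π (Gval α b) : ℚ))) :
    (GMatrix p α n b 0).rank = n := by
  have hhom := isWeightedHomogeneous_sum_monomial α b
  have hΔ := isWeightedHomogeneous_red_deltaLift (p := p) α b
  refine Matrix.rank_eq_of_forall_exists fun r => ?_
  obtain ⟨h, hh, h1, h2⟩ := exists_nu_of_isNQuasiFSplitPair hq hf (red_Glift α b) (Glift_pow α b)
    hhom hΔ (n := r + 1) (by omega) (fun s hs => nu_self_eq_zero (n := n) hq (red_Glift α b)
      (Glift_pow α b) hhom hΔ hns s (by have := r.2; omega))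
    (hpair (r + 1) (by omega) (by have := r.2; omega))
  rw [eq_Gval α hh] at h1 h2
  refine ⟨fun i => coeff (α i).1 h, fun s hs => ?_, fun h0 => h2 ?_⟩
  · rw [GMatrix_mulVec_eq_zero_iff]
    exact h1 s (by have : (s : ℕ) < r := hs; omega)
  · rw [GMatrix_mulVec_eq_zero_iff] at h0
    exact h0

theorem theorem3p5 (p : ℕ) [Fact p.Prime] {k : Type*} [Field k] [CharP k p]
    [IsAlgClosed k] {N m : ℕ} (q : Fin (N + 1) → ℕ) (hq : ∀ j, 0 < q j)
    (α : Fin m ≃ CYFamily.Exponents q) (b : Fin m → k) (hb : b ≠ 0) :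
    (∃ r : ℕ, IsLeast {n : ℕ | 1 ≤ n ∧ (CYFamily.GMatrix p α n b 0).rank ≤ n - 1} r ∧
      (r : ℕ∞) ≤ nonSplittingIndex p (CYFamily.Gval α b) ∧
      (¬ IsQuasiFSplit p (MvPolynomial (Fin (N + 1)) k ⧸ Ideal.span {CYFamily.Gval α b}) →
        nonSplittingIndex p (CYFamily.Gval α b) = (r : ℕ∞))) ∧
    (∀ n : ℕ, 1 ≤ n →
      (n : ℕ∞) ≤ qFSplitHeight p
        (MvPolynomial (Fin (N + 1)) k ⧸ Ideal.span {CYFamily.Gval α b}) →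
      ((n + 1 : ℕ) : ℕ∞) ≤ nonSplittingIndex p (CYFamily.Gval α b) →
      (CYFamily.GMatrix p α n b 0).rank = n) := by
  have hf : CYFamily.Gval α b ≠ 0 := by
    obtain ⟨i, hi⟩ := Function.ne_iff.1 hb
    intro h
    apply hi
    rw [← WittSection.coeff_Gval α b i, h]
    exact MvPolynomial.coeff_zero _
  have hsplit : ∀ n : ℕ, 1 ≤ n → (CYFamily.GMatrix p α n b 0).rank = n →
      IsNQuasiFSplitPair p n (MvPolynomial (Fin (N + 1)) k)
        (fun π => (1 - 2 / (p : ℚ) ^ n) * (multiplicity π (CYFamily.Gval α b) : ℚ)) :=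
    fun n hn h => isNQuasiFSplitPair_of_rank_eq p hq α hf hn h
  have hrank : ∀ n : ℕ, 1 ≤ n →
      (n : ℕ∞) ≤ qFSplitHeight p
        (MvPolynomial (Fin (N + 1)) k ⧸ Ideal.span {CYFamily.Gval α b}) →
      ((n + 1 : ℕ) : ℕ∞) ≤ nonSplittingIndex p (CYFamily.Gval α b) →
      (CYFamily.GMatrix p α n b 0).rank = n := by
    intro n _ hht hns
    refine rank_eq_of_isNQuasiFSplitPair p hq α hf (fun r hr hrn h => ?_) (fun r hr hrn => ?_)
    · have : qFSplitHeight p (MvPolynomial (Fin (N + 1)) k ⧸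
          Ideal.span {CYFamily.Gval α b}) ≤ (r : ℕ∞) := iInf₂_le r ⟨hr, h⟩
      exact absurd (Nat.cast_le.1 (hht.trans this)) (by omega)
    · by_contra h
      have : nonSplittingIndex p (CYFamily.Gval α b) ≤ (r : ℕ∞) := iInf₂_le r ⟨hr, h⟩
      exact absurd (Nat.cast_le.1 (hns.trans this)) (by omega)
  refine ⟨?_, hrank⟩
  -- A matrix with m columns has rank at most m, so m + 1 rows are dependent.
  have hex : ∃ n, 1 ≤ n ∧ (CYFamily.GMatrix p α n b 0).rank ≤ n - 1 :=
    ⟨m + 1, by omega, Matrix.rank_le_width _⟩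
  classical
  have hr := Nat.find_spec hex
  have hmin : ∀ n, 1 ≤ n → n < Nat.find hex → (CYFamily.GMatrix p α n b 0).rank = n := by
    intro n hn hlt
    have h1 := Nat.find_min hex hlt
    have h2 := Matrix.rank_le_height (CYFamily.GMatrix p α n b 0)
    by_contra h3
    exact h1 ⟨hn, by omega⟩
  have hle : (Nat.find hex : ℕ∞) ≤ nonSplittingIndex p (CYFamily.Gval α b) := by
    refine le_iInf₂ fun n hn => ?_
    rw [Nat.cast_le]
    by_contra! hlt
    exact hn.2 (hsplit n hn.1 (hmin n hn.1 hlt))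
  refine ⟨Nat.find hex, ⟨hr, fun n hn => Nat.find_min' hex hn⟩, hle, fun hnot => ?_⟩
  refine le_antisymm ?_ hle
  by_contra! hlt
  have hht : ∀ n : ℕ, (n : ℕ∞) ≤ qFSplitHeight p
      (MvPolynomial (Fin (N + 1)) k ⧸ Ideal.span {CYFamily.Gval α b}) := fun n =>
    le_iInf₂ fun l hl => absurd ⟨l, hl⟩ hnot
  -- With infinite height, an index beyond the minimum would force full rank at the minimum itself.
  have h1 := hrank (Nat.find hex) hr.1 (hht _) (by
    rw [Nat.cast_add, Nat.cast_one]
    exact Order.add_one_le_of_lt hlt)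
  have h2 := hr.2
  have h3 := hr.1
  omega
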